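/- Let $\Gamma$ be a metric graph with (arbitrary) vertex set $V$ and edge set $E$: each edge $e\in E$ is identified with an open interval $(a_e,b_e)$, $-\infty\le a_e<b_e\le\infty$; put $E_l=\{e: a_e>-\infty\}$ and $E_r=\{e: b_e<\infty\}$, and let $\gamma_l\colon E_l\to V$, $\gamma_r\colon E_r\to V$ assign the starting and termination vertices. Assume $\inf_{e\in E}(b_e-a_e)>0$. Let $(\alpha_e)_{e\in E}$ be a family in $(0,\infty)$ that is bounded and bounded away from zero, and $(\beta_e)_{e\in E}$ a bounded family of real numbers. In the complex Hilbert space $\mathcal H_\Gamma=\bigoplus_{e\in E}L_2(a_e,b_e)$ let $\hat A$ be the operator with domain the Hilbert sum $D(\hat A)=\bigoplus_{e\in E}W_2^3(a_e,b_e)$ and $(\hat A u)_e=\alpha_e\,\partial^3u_e+\beta_e\,\partial u_e$. For $u\in D(\hat A)$ let $$\mathrm{Tr}_l u=\bigl((u_e^{(k)}(a_e+))_{e\in E_l}\bigr)_{k=0,1,2}\in\ell_2(E_l)^3,\qquad \mathrm{Tr}_r u=\bigl((u_e^{(k)}(b_e-))_{e\in E_r}\bigr)_{k=0,1,2}\in\ell_2(E_r)^3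 .$$ For $j\in\{l,r\}$ let $\mathcal K_j$ be the Krein space $\ell_2(E_j)^3$ with the indefinite inner product $\langle x\mid y\rangle_j=(B_jx,y)_{\ell_2(E_j)^3}$, where $$B_j=\begin{pmatrix}-\beta_j&0&-\alpha_j\\0&\alpha_j&0\\-\alpha_j&0&0\end{pmatrix}$$ and $\alpha_j,\beta_j$ denote multiplication by $(\alpha_e)_{e\in E_j}$, $(\beta_e)_{e\in E_j}$. Let $L$ be a (possibly unbounded) linear operator from $\ell_2(E_r)^3$ to $\ell_2(E_l)^3$ whose domain $D(L)$ and range $R(L)$ are dense, and let $A_L$ be the restriction of $\hat A$ to $$D(A_L)=\{u\in D(\hat A):\ \mathrm{Tr}_r u\in D(L),\ L\,\mathrm{Tr}_r u=\mathrm{Tr}_l u\}.$$ Then $A_L$ is skew-self-adjoint (densely defined with $A_L^*=-A_L$) if and only if $L$ is $(\mathcal K_r,\mathcal K_l)$-unitary, i.e. $D(L)$ and $R(L)$ are dense, $L$ is injective and $L^\sharp=L^{-1}$ (with equality of domains). Here $L^\sharp$ is the operator from $\mathcal K_l$ to $\mathcal K_r$ such that $y\in D(L^\sharp)$ and $L^\sharp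 y=z$ if and only if $\langle Lx\mid y\rangle_l=\langle x\mid z\rangle_r$ for all $x\in D(L)$. -/

import Mathlib

open MeasureTheory Filter Topology Set
open scoped ENNReal ContDiff

noncomputable section

/-! ### Metric graphs -/

/-- A metric graph with vertex set `V` and edge set `E`: the edge `e` is the open interval
`(a e, b e)` with `-∞ ≤ a e < b e ≤ ∞`; the map `γl` sends an edge with finite left end point to
its starting vertex and `γr` sends an edge with finite right end point to its terminal vertex. -/
structure MetricGraph (V E : Type*) where
  a : E → EReal
  b : E → EReal
  a_lt_b : ∀ e, a e < b e
  γl : {e : E // ⊥ < a e} → V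
  γr : {e : E // b e < ⊤} → V

/-- Coefficient families `α`, `β`: real, `α` positive, bounded and bounded away from zero,
`β` bounded. -/
structure AiryCoeffs (ι : Type*) where
  α : ι → ℝ
  β : ι → ℝ
  α_bounds : ∃ c C : ℝ, 0 < c ∧ ∀ i, c ≤ α i ∧ α i ≤ C
  β_bounds : ∃ C : ℝ, ∀ i, |β i| ≤ C

/-- Restriction of the coefficients to a subset of the index set. -/
def AiryCoeffs.restrict {ι : Type*} (c : AiryCoeffs ι) (p : ι → Prop) :
    AiryCoeffs {i // p i} where
  α i := c.α i
  β i := c.β i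
  α_bounds := by
    obtain ⟨m, C, hm, h⟩ := c.α_bounds
    exact ⟨m, C, hm, fun i => h i⟩
  β_bounds := by
    obtain ⟨C, h⟩ := c.β_bounds
    exact ⟨C, fun i => h i⟩

/-! ### Multiplication operators on Hilbert sums -/

/-- Multiplication by a bounded real family `c` on the Hilbert sum `⨁ᵢ F i`:
`(u i)ᵢ ↦ (c i • u i)ᵢ`. -/
def mulOp {ι : Type*} {F : ι → Type*} [∀ i, NormedAddCommGroup (F i)]
    [∀ i, NormedSpace ℂ (F i)] (c : ι → ℝ) (hc : ∃ C : ℝ, ∀ i, |c i| ≤ C) :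
    lp F 2 →L[ℂ] lp F 2 :=
  have key : ∀ C : ℝ, (∀ i, |c i| ≤ C) → ∀ (u : lp F 2) (i : ι),
      ‖((c i : ℝ) : ℂ) • u i‖ ≤ ‖(((|C| : ℝ) : ℂ) • u) i‖ := fun C hC u i => by
    rw [lp.coeFn_smul, Pi.smul_apply, norm_smul, norm_smul]
    refine mul_le_mul_of_nonneg_right ?_ (norm_nonneg _)
    simpa using (hC i).trans (le_abs_self C)
  let f : lp F 2 →ₗ[ℂ] lp F 2 :=
    { toFun := fun u => ⟨fun i => ((c i : ℝ) : ℂ) • u i, by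
        obtain ⟨C, hC⟩ := hc
        exact (lp.memℓp (((|C| : ℝ) : ℂ) • u)).mono' (key C hC u)⟩
      map_add' := fun u v => by
        ext i
        exact smul_add _ _ _
      map_smul' := fun z u => by
        ext i
        exact smul_comm _ _ _ }
  f.mkContinuousOfExistsBound (by
    obtain ⟨C, hC⟩ := hc
    refine ⟨|C|, fun u => ?_⟩
    have h : ‖f u‖ ≤ ‖((|C| : ℝ) : ℂ) • u‖ :=
      lp.norm_mono (by norm_num) (key C hC u)
    refine h.trans (le_of_eq ?_)
    rw [norm_smul]
    simp)

@[simp]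
theorem mulOp_apply {ι : Type*} {F : ι → Type*} [∀ i, NormedAddCommGroup (F i)]
    [∀ i, NormedSpace ℂ (F i)] (c : ι → ℝ) (hc : ∃ C : ℝ, ∀ i, |c i| ≤ C) (u : lp F 2) (i : ι) :
    mulOp c hc u i = ((c i : ℝ) : ℂ) • u i := rfl

theorem AiryCoeffs.α_abs {ι : Type*} (c : AiryCoeffs ι) : ∃ C : ℝ, ∀ i, |c.α i| ≤ C := by
  obtain ⟨m, C, hm, h⟩ := c.α_bounds
  exact ⟨C, fun i => by rw [abs_of_pos (hm.trans_le (h i).1)]; exact (h i).2⟩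

theorem AiryCoeffs.α_pos {ι : Type*} (c : AiryCoeffs ι) (i : ι) : 0 < c.α i := by
  obtain ⟨m, C, hm, h⟩ := c.α_bounds
  exact hm.trans_le (h i).1

theorem AiryCoeffs.α_inv_abs {ι : Type*} (c : AiryCoeffs ι) :
    ∃ C : ℝ, ∀ i, |(c.α i)⁻¹| ≤ C := by
  obtain ⟨m, C, hm, h⟩ := c.α_bounds
  refine ⟨m⁻¹, fun i => ?_⟩
  rw [abs_of_pos (inv_pos.2 (hm.trans_le (h i).1))]
  exact inv_anti₀ hm (h i).1

/-- Multiplication by `α`. -/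
def AiryCoeffs.mulα {ι : Type*} (c : AiryCoeffs ι) {F : ι → Type*}
    [∀ i, NormedAddCommGroup (F i)] [∀ i, NormedSpace ℂ (F i)] : lp F 2 →L[ℂ] lp F 2 :=
  mulOp c.α c.α_abs

/-- Multiplication by `β`. -/
def AiryCoeffs.mulβ {ι : Type*} (c : AiryCoeffs ι) {F : ι → Type*}
    [∀ i, NormedAddCommGroup (F i)] [∀ i, NormedSpace ℂ (F i)] : lp F 2 →L[ℂ] lp F 2 :=
  mulOp c.β c.β_bounds

/-! ### Krein spaces and unitary operators between them -/

/-- A Krein space structure on a Hilbert space `K`, inducing its topology: the indefinite inner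
product is `⟨x | y⟩ = (G x, y)` with a bounded, self-adjoint, boundedly invertible Gram
operator `G`. -/
structure KreinSpace (K : Type*) [NormedAddCommGroup K] [InnerProductSpace ℂ K]
    [CompleteSpace K] where
  gram : K ≃L[ℂ] K
  gram_symm : ∀ x y : K, inner ℂ (gram x) y = inner ℂ x (gram y)

section Krein

variable {K₁ K₂ : Type*} [NormedAddCommGroup K₁] [InnerProductSpace ℂ K₁] [CompleteSpace K₁]
  [NormedAddCommGroup K₂] [InnerProductSpace ℂ K₂] [CompleteSpace K₂]

/-- The indefinite inner product of a Krein space. -/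
def KreinSpace.form (𝒦 : KreinSpace K₁) (x y : K₁) : ℂ := inner ℂ (𝒦.gram x) y

/-- The graph of the Krein space adjoint `L♯`: all `(y, z)` with `⟨L x | y⟩ = ⟨x | z⟩` for every
`x` in the domain of `L`. -/
def kreinAdjointGraph (𝒦₁ : KreinSpace K₁) (𝒦₂ : KreinSpace K₂) (L : K₁ →ₗ.[ℂ] K₂) :
    Submodule ℂ (K₂ × K₁) where
  carrier := {p | ∀ x : L.domain, 𝒦₂.form (L x) p.1 = 𝒦₁.form (x : K₁) p.2}
  zero_mem' := fun x => by simp [KreinSpace.form]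
  add_mem' := fun {p q} hp hq x => by
    have h1 := hp x
    have h2 := hq x
    simp only [KreinSpace.form, Prod.fst_add, Prod.snd_add, inner_add_right] at h1 h2 ⊢
    rw [h1, h2]
  smul_mem' := fun z p hp x => by
    have h1 := hp x
    simp only [KreinSpace.form, Prod.smul_fst, Prod.smul_snd, inner_smul_right] at h1 ⊢
    rw [h1]

/-- For densely defined `L` the Krein space adjoint is single-valued. -/
theorem kreinAdjointGraph_snd_eq_zero (𝒦₁ : KreinSpace K₁) (𝒦₂ : KreinSpace K₂)
    (L : K₁ →ₗ.[ℂ] K₂) (hL : Dense (L.domain : Set K₁)) (p : K₂ × K₁)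
    (hp : p ∈ kreinAdjointGraph 𝒦₁ 𝒦₂ L) (hp1 : p.1 = 0) : p.2 = 0 := by
  have h : 𝒦₁.gram p.2 = 0 := by
    refine hL.eq_zero_of_inner_right ℂ (fun x hx => ?_)
    have h1 := hp ⟨x, hx⟩
    simp only [KreinSpace.form, hp1, inner_zero_right] at h1
    rw [← 𝒦₁.gram_symm, ← h1]
  simpa using h

/-- The Krein space adjoint `L♯` of a densely defined operator `L`, as a linear operator:
`y` is in its domain, with `L♯ y = z`, if and only if `⟨L x | y⟩ = ⟨x | z⟩` for all `x ∈ D(L)`. -/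
def kreinAdjoint (𝒦₁ : KreinSpace K₁) (𝒦₂ : KreinSpace K₂) (L : K₁ →ₗ.[ℂ] K₂) :
    K₂ →ₗ.[ℂ] K₁ :=
  (kreinAdjointGraph 𝒦₁ 𝒦₂ L).toLinearPMap

theorem kreinAdjoint_graph (𝒦₁ : KreinSpace K₁) (𝒦₂ : KreinSpace K₂) (L : K₁ →ₗ.[ℂ] K₂)
    (hL : Dense (L.domain : Set K₁)) :
    (kreinAdjoint 𝒦₁ 𝒦₂ L).graph = kreinAdjointGraph 𝒦₁ 𝒦₂ L :=
  Submodule.toLinearPMap_graph_eq _ (kreinAdjointGraph_snd_eq_zero 𝒦₁ 𝒦₂ L hL)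

/-- `L` is unitary between Krein spaces: domain and range are dense, `L` is injective, and
`L♯ = L⁻¹` as (unbounded) operators, including equality of domains. -/
def IsKreinUnitary (𝒦₁ : KreinSpace K₁) (𝒦₂ : KreinSpace K₂) (L : K₁ →ₗ.[ℂ] K₂) : Prop :=
  Dense (L.domain : Set K₁) ∧ Dense (Set.range L) ∧ Function.Injective L ∧
    kreinAdjoint 𝒦₁ 𝒦₂ L = L.inverse

/-- A densely defined operator in a Hilbert space is skew-self-adjoint if `A* = -A`. -/
def IsSkewSelfAdjointOp (A : K₁ →ₗ.[ℂ] K₁) : Prop :=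
  Dense (A.domain : Set K₁) ∧ A.adjoint = -A

end Krein

/-! ### The trace spaces `ℓ₂(ι)³` and their indefinite inner products -/

/-- The Hilbert space `ℓ₂(ι)³`. -/
abbrev TraceSpace (ι : Type*) : Type _ := PiLp 2 (fun _ : Fin 3 => lp (fun _ : ι => ℂ) 2)

/-- The block operator matrix with rows `(-β, 0, -α)`, `(0, α, 0)`, `(-α, 0, 0)`. -/
def AiryCoeffs.boundaryMatrix {ι : Type*} (c : AiryCoeffs ι) :
    (Fin 3 → lp (fun _ : ι => ℂ) 2) →L[ℂ] (Fin 3 → lp (fun _ : ι => ℂ) 2) :=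
  ContinuousLinearMap.pi
    ![-(c.mulβ ∘L ContinuousLinearMap.proj 0) - c.mulα ∘L ContinuousLinearMap.proj 2,
      c.mulα ∘L ContinuousLinearMap.proj 1,
      -(c.mulα ∘L ContinuousLinearMap.proj 0)]

/-- The inverse of the boundary matrix. -/
def AiryCoeffs.boundaryMatrixInv {ι : Type*} (c : AiryCoeffs ι) :
    (Fin 3 → lp (fun _ : ι => ℂ) 2) →L[ℂ] (Fin 3 → lp (fun _ : ι => ℂ) 2) :=
  let r : lp (fun _ : ι => ℂ) 2 →L[ℂ] lp (fun _ : ι => ℂ) 2 :=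
    mulOp (fun i => (c.α i)⁻¹) c.α_inv_abs
  ContinuousLinearMap.pi
    ![-(r ∘L ContinuousLinearMap.proj 2),
      r ∘L ContinuousLinearMap.proj 1,
      -(r ∘L ContinuousLinearMap.proj 0) +
        r ∘L c.mulβ ∘L r ∘L ContinuousLinearMap.proj 2]

theorem AiryCoeffs.boundaryMatrix_left_inv {ι : Type*} (c : AiryCoeffs ι) :
    Function.LeftInverse c.boundaryMatrixInv c.boundaryMatrix := by
  intro x
  funext k
  ext i
  have h : ((c.α i : ℝ) : ℂ) ≠ 0 := by exact_mod_cast (c.α_pos i).ne'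
  fin_cases k
  · simp [boundaryMatrix, boundaryMatrixInv, mulα, mulβ, h]
  · simp [boundaryMatrix, boundaryMatrixInv, mulα, mulβ, h]
  · simp [boundaryMatrix, boundaryMatrixInv, mulα, mulβ]
    field_simp
    ring

theorem AiryCoeffs.boundaryMatrix_right_inv {ι : Type*} (c : AiryCoeffs ι) :
    Function.RightInverse c.boundaryMatrixInv c.boundaryMatrix := by
  intro x
  funext k
  ext i
  have h : ((c.α i : ℝ) : ℂ) ≠ 0 := by exact_mod_cast (c.α_pos i).ne'
  fin_cases k
  · simp [boundaryMatrix, boundaryMatrixInv, mulα, mulβ]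
    field_simp
    ring
  · simp [boundaryMatrix, boundaryMatrixInv, mulα, mulβ, h]
  · simp [boundaryMatrix, boundaryMatrixInv, mulα, mulβ, h]

theorem inner_mulOp {ι : Type*} (c : ι → ℝ) (hc : ∃ C : ℝ, ∀ i, |c i| ≤ C)
    (x y : lp (fun _ : ι => ℂ) 2) : inner ℂ (mulOp c hc x) y = inner ℂ x (mulOp c hc y) := by
  rw [lp.inner_eq_tsum, lp.inner_eq_tsum]
  refine tsum_congr fun i => ?_
  simp only [mulOp_apply, inner_smul_left, inner_smul_right, Complex.conj_ofReal]

/-- The trace space `ℓ₂(ι)³` as a Krein space, with Gram operator the boundary matrix. -/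
def AiryCoeffs.krein {ι : Type*} (c : AiryCoeffs ι) : KreinSpace (TraceSpace ι) where
  gram := (PiLp.continuousLinearEquiv 2 ℂ (fun _ : Fin 3 => lp (fun _ : ι => ℂ) 2)).trans
    ((ContinuousLinearEquiv.equivOfInverse c.boundaryMatrix c.boundaryMatrixInv
      c.boundaryMatrix_left_inv c.boundaryMatrix_right_inv).trans
    (PiLp.continuousLinearEquiv 2 ℂ (fun _ : Fin 3 => lp (fun _ : ι => ℂ) 2)).symm)
  gram_symm := fun x y => by
    simp only [PiLp.inner_apply, Fin.sum_univ_three]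
    simp [AiryCoeffs.boundaryMatrix, AiryCoeffs.mulα, AiryCoeffs.mulβ, inner_mulOp,
      inner_sub_left, inner_sub_right]
    ring

/-! ### Function spaces on a metric graph -/

/-- `w` is the weak derivative of `u` on the open set `I ⊆ ℝ`. -/
def HasWeakDerivOn (I : Set ℝ) (u w : ℝ → ℂ) : Prop :=
  ∀ φ : ℝ → ℝ, ContDiff ℝ ∞ φ → HasCompactSupport φ → tsupport φ ⊆ I →
    ∫ x in I, deriv φ x • u x = -∫ x in I, φ x • w x

/-- `f`, defined almost everywhere on `I`, has a continuous representative on `I` which tends to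
`z` along the filter `l`. -/
def HasBoundaryValue (I : Set ℝ) (l : Filter ℝ) (f : ℝ → ℂ) (z : ℂ) : Prop :=
  ∃ g : ℝ → ℂ, ContinuousOn g I ∧ f =ᵐ[volume.restrict I] g ∧ Tendsto g l (𝓝 z)

namespace MetricGraph

variable {V E : Type*} (G : MetricGraph V E)

/-- The edges with finite starting point. -/
abbrev El : Type _ := {e : E // ⊥ < G.a e}

/-- The edges with finite termination point. -/
abbrev Er : Type _ := {e : E // G.b e < ⊤}

/-- The open interval `(a e, b e)` as a subset of `ℝ`. -/
def edge (e : E) : Set ℝ := {x : ℝ | G.a e < (x : EReal) ∧ (x : EReal) < G.b e}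

theorem isOpen_edge (e : E) : IsOpen (G.edge e) :=
  (isOpen_lt continuous_const continuous_coe_real_ereal).inter
    (isOpen_lt continuous_coe_real_ereal continuous_const)

/-- The Hilbert space `⨁_{e ∈ E} L₂(a e, b e)`. -/
abbrev HΓ : Type _ := lp (fun e : E => Lp ℂ 2 (volume.restrict (G.edge e))) 2

variable {G}

/-- Edgewise weak derivative: `w e` is the weak derivative of `u e` for all `e`. -/
def IsWeakDeriv (u w : G.HΓ) : Prop := ∀ e, HasWeakDerivOn (G.edge e) (u e) (w e)

theorem integrable_smul_test {I : Set ℝ} (u : Lp ℂ 2 (volume.restrict I)) {φ : ℝ → ℝ}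
    (hφ : Continuous φ) (hc : HasCompactSupport φ) :
    Integrable (fun x => φ x • u x) (volume.restrict I) :=
  ((Lp.memLp u).locallyIntegrable (by norm_num)).integrable_smul_left_of_hasCompactSupport hφ hc

theorem HasWeakDerivOn.add {I : Set ℝ} {u w u' w' : Lp ℂ 2 (volume.restrict I)}
    (h : HasWeakDerivOn I u w) (h' : HasWeakDerivOn I u' w') :
    HasWeakDerivOn I ((u + u' : Lp ℂ 2 (volume.restrict I)) : ℝ → ℂ)
      ((w + w' : Lp ℂ 2 (volume.restrict I)) : ℝ → ℂ) := by
  intro φ hφ hc hs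
  have hd : Continuous (deriv φ) := hφ.continuous_deriv (by simp)
  have e1 : ∫ x in I, deriv φ x • (u + u' : Lp ℂ 2 (volume.restrict I)) x =
      ∫ x in I, (deriv φ x • u x + deriv φ x • u' x) := by
    refine integral_congr_ae ?_
    filter_upwards [Lp.coeFn_add u u'] with x hx
    rw [hx, Pi.add_apply, smul_add]
  have e2 : ∫ x in I, φ x • (w + w' : Lp ℂ 2 (volume.restrict I)) x =
      ∫ x in I, (φ x • w x + φ x • w' x) := by
    refine integral_congr_ae ?_
    filter_upwards [Lp.coeFn_add w w'] with x hx
    rw [hx, Pi.add_apply, smul_add]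
  rw [e1, e2, integral_add (integrable_smul_test u hd hc.deriv)
    (integrable_smul_test u' hd hc.deriv), integral_add
    (integrable_smul_test w hφ.continuous hc) (integrable_smul_test w' hφ.continuous hc),
    h φ hφ hc hs, h' φ hφ hc hs]
  ring

theorem HasWeakDerivOn.smul {I : Set ℝ} {u w : Lp ℂ 2 (volume.restrict I)} (z : ℂ)
    (h : HasWeakDerivOn I u w) :
    HasWeakDerivOn I ((z • u : Lp ℂ 2 (volume.restrict I)) : ℝ → ℂ)
      ((z • w : Lp ℂ 2 (volume.restrict I)) : ℝ → ℂ) := by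
  intro φ hφ hc hs
  have e1 : ∫ x in I, deriv φ x • (z • u : Lp ℂ 2 (volume.restrict I)) x =
      ∫ x in I, z • (deriv φ x • u x) := by
    refine integral_congr_ae ?_
    filter_upwards [Lp.coeFn_smul z u] with x hx
    rw [hx, Pi.smul_apply, smul_comm]
  have e2 : ∫ x in I, φ x • (z • w : Lp ℂ 2 (volume.restrict I)) x =
      ∫ x in I, z • (φ x • w x) := by
    refine integral_congr_ae ?_
    filter_upwards [Lp.coeFn_smul z w] with x hx
    rw [hx, Pi.smul_apply, smul_comm]
  rw [e1, e2, integral_smul, integral_smul, h φ hφ hc hs, smul_neg]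

theorem isWeakDeriv_zero : IsWeakDeriv (0 : G.HΓ) 0 := by
  intro e φ _ _ _
  have h0 : ((0 : G.HΓ) e : ℝ → ℂ) =ᵐ[volume.restrict (G.edge e)] 0 := Lp.coeFn_zero _ _ _
  rw [integral_eq_zero_of_ae (h0.mono fun x hx => by
      change _ • ((0 : G.HΓ) e : ℝ → ℂ) x = 0
      rw [hx, Pi.zero_apply, smul_zero]),
    integral_eq_zero_of_ae (h0.mono fun x hx => by
      change _ • ((0 : G.HΓ) e : ℝ → ℂ) x = 0
      rw [hx, Pi.zero_apply, smul_zero]), neg_zero]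

theorem IsWeakDeriv.add {u w u' w' : G.HΓ} (h : IsWeakDeriv u w) (h' : IsWeakDeriv u' w') :
    IsWeakDeriv (u + u') (w + w') := fun e => HasWeakDerivOn.add (h e) (h' e)

theorem IsWeakDeriv.smul {u w : G.HΓ} (z : ℂ) (h : IsWeakDeriv u w) :
    IsWeakDeriv (z • u) (z • w) := fun e => HasWeakDerivOn.smul z (h e)

theorem IsWeakDeriv.eq_zero {w : G.HΓ} (h : IsWeakDeriv 0 w) : w = 0 := by
  ext1
  funext e
  have h0 : ((0 : G.HΓ) e : ℝ → ℂ) =ᵐ[volume.restrict (G.edge e)] 0 := Lp.coeFn_zero _ _ _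
  have hw := (G.isOpen_edge e).ae_eq_zero_of_integral_contDiff_smul_eq_zero
    (μ := volume.restrict (G.edge e)) (f := (w e : ℝ → ℂ))
    (((Lp.memLp (w e)).locallyIntegrable (by norm_num)).locallyIntegrableOn _)
    (fun φ hφ hc hs => by
      have h1 := h e φ hφ hc hs
      rw [integral_eq_zero_of_ae (h0.mono fun x hx => by
      change _ • ((0 : G.HΓ) e : ℝ → ℂ) x = 0
      rw [hx, Pi.zero_apply, smul_zero])] at h1
      exact neg_eq_zero.1 h1.symm)
  refine Lp.ext ?_
  filter_upwards [hw, ae_restrict_mem (G.isOpen_edge e).measurableSet, h0] with x hx hxe hx0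
  rw [hx hxe]
  exact hx0.symm

variable (G)

/-- All pairs `(u, (w₀, w₁, w₂, w₃))` of elements of the Hilbert sum with `w₀ = u` and `wₖ₊₁` the
edgewise weak derivative of `wₖ`. -/
def jetGraph : Submodule ℂ (G.HΓ × (Fin 4 → G.HΓ)) where
  carrier := {p | p.2 0 = p.1 ∧ ∀ k : Fin 3, IsWeakDeriv (p.2 k.castSucc) (p.2 k.succ)}
  zero_mem' := ⟨rfl, fun _ => isWeakDeriv_zero⟩
  add_mem' := fun {p q} hp hq =>
    ⟨by simp [hp.1, hq.1], fun k => (hp.2 k).add (hq.2 k)⟩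
  smul_mem' := fun z p hp => ⟨by simp [hp.1], fun k => (hp.2 k).smul z⟩

theorem jetGraph_snd_eq_zero (p : G.HΓ × (Fin 4 → G.HΓ)) (hp : p ∈ G.jetGraph)
    (hp1 : p.1 = 0) : p.2 = 0 := by
  funext k
  induction k using Fin.induction with
  | zero => exact hp.1.trans hp1
  | succ k ih =>
    have h := hp.2 k
    rw [ih] at h
    exact h.eq_zero

/-- The map `u ↦ (u, ∂u, ∂²u, ∂³u)` (edgewise weak derivatives). Its domain is the Hilbert sum
`⨁_{e ∈ E} W₂³(a e, b e)`, i.e. all families `u` for which the weak derivatives of order at most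
three of all `u e` exist in `L₂` and the squares of the `W₂³`-norms of the `u e` are summable. -/
def jet : G.HΓ →ₗ.[ℂ] (Fin 4 → G.HΓ) := G.jetGraph.toLinearPMap

theorem jet_graph : G.jet.graph = G.jetGraph :=
  Submodule.toLinearPMap_graph_eq _ G.jetGraph_snd_eq_zero

/-- The Hilbert sum `⨁_{e ∈ E} W₂³(a e, b e)`. -/
def W3 : Submodule ℂ G.HΓ := G.jet.domain

/-- The `k`-th derivative `∂ᵏ`, `k = 0, 1, 2, 3`, on `⨁_{e ∈ E} W₂³(a e, b e)`. -/
def D (k : Fin 4) : G.W3 →ₗ[ℂ] G.HΓ := LinearMap.proj k ∘ₗ G.jet.toFun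

/-- The maximal operator `(Â u) e = α e ∂³ (u e) + β e ∂ (u e)` on `⨁_{e ∈ E} W₂³(a e, b e)`. -/
def maxOp (c : AiryCoeffs E) : G.HΓ →ₗ.[ℂ] G.HΓ where
  domain := G.W3
  toFun := c.mulα.toLinearMap ∘ₗ G.D 3 + c.mulβ.toLinearMap ∘ₗ G.D 1

variable {G}

/-- `Tr_l u = x`: for `k = 0, 1, 2` and every edge `e` with finite starting point, the
continuous representative of `∂ᵏ(u e)` tends to `x k e` at `a e` from the right. -/
def IsTrl (u : G.W3) (x : TraceSpace G.El) : Prop :=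
  ∀ (k : Fin 3) (e : G.El), HasBoundaryValue (G.edge e) (𝓝[>] (G.a e).toReal)
    (G.D k.castSucc u e) (x k e)

/-- `Tr_r u = x`: for `k = 0, 1, 2` and every edge `e` with finite termination point, the
continuous representative of `∂ᵏ(u e)` tends to `x k e` at `b e` from the left. -/
def IsTrr (u : G.W3) (x : TraceSpace G.Er) : Prop :=
  ∀ (k : Fin 3) (e : G.Er), HasBoundaryValue (G.edge e) (𝓝[<] (G.b e).toReal)
    (G.D k.castSucc u e) (x k e)

theorem HasBoundaryValue.zero (I : Set ℝ) (l : Filter ℝ) :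
    HasBoundaryValue I l ((0 : Lp ℂ 2 (volume.restrict I)) : ℝ → ℂ) 0 :=
  ⟨0, continuousOn_const, Lp.coeFn_zero _ _ _, tendsto_const_nhds⟩

theorem HasBoundaryValue.add {I : Set ℝ} {l : Filter ℝ} {f g : Lp ℂ 2 (volume.restrict I)}
    {z w : ℂ} (hf : HasBoundaryValue I l f z) (hg : HasBoundaryValue I l g w) :
    HasBoundaryValue I l ((f + g : Lp ℂ 2 (volume.restrict I)) : ℝ → ℂ) (z + w) := by
  obtain ⟨f', hf1, hf2, hf3⟩ := hf
  obtain ⟨g', hg1, hg2, hg3⟩ := hg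
  exact ⟨f' + g', hf1.add hg1, (Lp.coeFn_add f g).trans (hf2.add hg2), hf3.add hg3⟩

theorem HasBoundaryValue.smul {I : Set ℝ} {l : Filter ℝ} {f : Lp ℂ 2 (volume.restrict I)}
    {z : ℂ} (a : ℂ) (hf : HasBoundaryValue I l f z) :
    HasBoundaryValue I l ((a • f : Lp ℂ 2 (volume.restrict I)) : ℝ → ℂ) (a • z) := by
  obtain ⟨f', hf1, hf2, hf3⟩ := hf
  exact ⟨a • f', hf1.const_smul a, (Lp.coeFn_smul a f).trans (hf2.const_smul a),
    hf3.const_smul a⟩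

/-- Boundary values at the end points of an interval are unique. -/
theorem HasBoundaryValue.unique {I : Set ℝ} (hI : IsOpen I) {l : Filter ℝ} [l.NeBot]
    (hl : I ∈ l) {f : ℝ → ℂ} {z w : ℂ} (hz : HasBoundaryValue I l f z)
    (hw : HasBoundaryValue I l f w) : z = w := by
  obtain ⟨g, hg1, hg2, hg3⟩ := hz
  obtain ⟨g', hg1', hg2', hg3'⟩ := hw
  have h : EqOn g g' I :=
    Measure.eqOn_open_of_ae_eq (hg2.symm.trans hg2') hI hg1 hg1'
  exact tendsto_nhds_unique hg3 (hg3'.congr' (by filter_upwards [hl] with x hx using (h hx).symm))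

theorem edge_mem_nhdsGT (e : G.El) : G.edge e ∈ 𝓝[>] (G.a e).toReal := by
  have ha : ((G.a e).toReal : EReal) = G.a e :=
    EReal.coe_toReal (ne_top_of_lt (G.a_lt_b e)) e.2.ne'
  have h1 : {x : ℝ | (x : EReal) < G.b e} ∈ 𝓝[>] (G.a e).toReal :=
    mem_nhdsWithin_of_mem_nhds
      ((isOpen_lt continuous_coe_real_ereal continuous_const).mem_nhds (by
        change ((G.a e).toReal : EReal) < G.b e
        rw [ha]
        exact G.a_lt_b e))
  filter_upwards [h1, self_mem_nhdsWithin] with x hx hxa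
  refine ⟨?_, hx⟩
  rw [← ha]
  exact_mod_cast hxa

theorem edge_mem_nhdsLT (e : G.Er) : G.edge e ∈ 𝓝[<] (G.b e).toReal := by
  have hb : ((G.b e).toReal : EReal) = G.b e :=
    EReal.coe_toReal e.2.ne (ne_bot_of_gt (G.a_lt_b e))
  have h1 : {x : ℝ | G.a e < (x : EReal)} ∈ 𝓝[<] (G.b e).toReal :=
    mem_nhdsWithin_of_mem_nhds
      ((isOpen_lt continuous_const continuous_coe_real_ereal).mem_nhds (by
        change G.a e < ((G.b e).toReal : EReal)
        rw [hb]
        exact G.a_lt_b e))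
  filter_upwards [h1, self_mem_nhdsWithin] with x hx hxb
  refine ⟨hx, ?_⟩
  rw [← hb]
  exact_mod_cast hxb

theorem IsTrl.unique {u : G.W3} {x y : TraceSpace G.El} (hx : IsTrl u x) (hy : IsTrl u y) :
    x = y := by
  ext k e
  exact HasBoundaryValue.unique (z := x k e) (w := y k e) (G.isOpen_edge e) (edge_mem_nhdsGT e) (hx k e) (hy k e)

theorem IsTrr.unique {u : G.W3} {x y : TraceSpace G.Er} (hx : IsTrr u x) (hy : IsTrr u y) :
    x = y := by
  ext k e
  exact HasBoundaryValue.unique (z := x k e) (w := y k e) (G.isOpen_edge e) (edge_mem_nhdsLT e) (hx k e) (hy k e)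

/-- The domain of `A_L`: all `u ∈ ⨁_{e ∈ E} W₂³(a e, b e)` with `Tr_r u ∈ D(L)` and
`L (Tr_r u) = Tr_l u`. -/
def domAL (L : TraceSpace G.Er →ₗ.[ℂ] TraceSpace G.El) : Submodule ℂ G.W3 where
  carrier := {u | ∃ x : L.domain, IsTrr u (x : TraceSpace G.Er) ∧ IsTrl u (L x)}
  zero_mem' := ⟨0, fun k e => by simpa using HasBoundaryValue.zero _ _,
    fun k e => by simpa using HasBoundaryValue.zero _ _⟩
  add_mem' := fun {u v} ⟨x, hx, hx'⟩ ⟨y, hy, hy'⟩ => ⟨x + y,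
    fun k e => by
      rw [map_add]
      exact HasBoundaryValue.add (hx k e) (hy k e),
    fun k e => by
      rw [map_add, LinearPMap.map_add]
      exact HasBoundaryValue.add (hx' k e) (hy' k e)⟩
  smul_mem' := fun z u ⟨x, hx, hx'⟩ => ⟨z • x,
    fun k e => by
      rw [map_smul]
      exact HasBoundaryValue.smul z (hx k e),
    fun k e => by
      rw [map_smul, LinearPMap.map_smul]
      exact HasBoundaryValue.smul z (hx' k e)⟩

/-- The operator `A_L`: the restriction of the maximal operator to the functions satisfying the
boundary condition `L (Tr_r u) = Tr_l u`. -/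
def opAL (c : AiryCoeffs E) (L : TraceSpace G.Er →ₗ.[ℂ] TraceSpace G.El) :
    G.HΓ →ₗ.[ℂ] G.HΓ :=
  (G.maxOp c).domRestrict ((domAL L).map G.W3.subtype)

variable (G)

/-- The Krein space `𝒦_l`, i.e. `ℓ₂(E_l)³` with the form induced by `B_l`. -/
def kreinL (c : AiryCoeffs E) : KreinSpace (TraceSpace G.El) :=
  (c.restrict (fun e => ⊥ < G.a e)).krein

/-- The Krein space `𝒦_r`, i.e. `ℓ₂(E_r)³` with the form induced by `B_r`. -/
def kreinR (c : AiryCoeffs E) : KreinSpace (TraceSpace G.Er) :=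
  (c.restrict (fun e => G.b e < ⊤)).krein

end MetricGraph

end

/-! Write `[p, q]` for the boundary form `greenForm` of `α∂³ + β∂`. Integration by parts on each
edge, summed over the graph, gives `(Âu, v) + (u, Âv) = ⟨Tr_l u | Tr_l v⟩_l - ⟨Tr_r u | Tr_r v⟩_r`;
the matrices `B_j` are exactly minus `[·, ·]`, written in the traces. Infinite ends contribute
nothing, since there the form is integrable and has a limit.

Two further facts turn this into the theorem. The pair `(Tr_l, Tr_r)` maps the Hilbert sum of the
`W₂³` onto the product of both trace spaces (`exists_W3_of_traces`), and the adjoint of `Â`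
restricted to functions with zero traces is contained in `-Â` (`exists_W3_of_forall_inner_maxOp`).
Hence `A_L*` is the restriction of `-Â` to those `v` with `L♯ Tr_l v = Tr_r v`, while `-A_L` is the
restriction of `-Â` to those with `L Tr_r v = Tr_l v`. As every pair of traces occurs, the two
operators agree if and only if the graph of `L♯` is the flipped graph of `L`. Density of `D(A_L)` is
automatic, because test functions lie in it, and injectivity of `L` follows because `L♯` is
single-valued.

The analytic difficulty is uniformity over infinitely many edges. It rests on one estimate
(`IsJetOn.exists_pointwise_bound`): pairing `u` in Green's formula with a cutoff whose two-jet at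
`x` is prescribed bounds `u(x)`, `u'(x)`, `u''(x)` by local `L₂` norms of `u` and `αu''' + βu'`
only. The constant depends on the coefficient bounds and on a step length that fits into all edges.
This makes the traces square-summable and places weak solutions in the Hilbert sum. -/

/-! ### Calculus of primitives on an interval -/

/-- `w` is integrable between any two points of `I` and `u` is a primitive of `w` on `I`. -/
def IsPrimitiveOn (I : Set ℝ) (u w : ℝ → ℂ) : Prop :=
  ∀ x ∈ I, ∀ y ∈ I, IntervalIntegrable w volume x y ∧ ∫ t in x..y, w t = u y - u x

namespace IsPrimitiveOn

variable {I : Set ℝ} {u w v z : ℝ → ℂ}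

theorem add (h : IsPrimitiveOn I u w) (h' : IsPrimitiveOn I v z) :
    IsPrimitiveOn I (fun x => u x + v x) (fun x => w x + z x) := fun x hx y hy => by
  refine ⟨(h x hx y hy).1.add (h' x hx y hy).1, ?_⟩
  rw [intervalIntegral.integral_add (h x hx y hy).1 (h' x hx y hy).1, (h x hx y hy).2,
    (h' x hx y hy).2]
  ring

theorem const_mul (c : ℂ) (h : IsPrimitiveOn I u w) :
    IsPrimitiveOn I (fun x => c * u x) (fun x => c * w x) := fun x hx y hy => by
  refine ⟨(h x hx y hy).1.const_mul c, ?_⟩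
  rw [intervalIntegral.integral_const_mul, (h x hx y hy).2, mul_sub]

theorem add_const (c : ℂ) (h : IsPrimitiveOn I u w) : IsPrimitiveOn I (fun x => u x + c) w :=
  fun x hx y hy => ⟨(h x hx y hy).1, by rw [(h x hx y hy).2]; ring⟩

theorem conj (h : IsPrimitiveOn I u w) :
    IsPrimitiveOn I (fun x => starRingEnd ℂ (u x)) (fun x => starRingEnd ℂ (w x)) :=
  fun x hx y hy => by
  refine ⟨?_, ?_⟩
  · have h1 := (h x hx y hy).1
    rw [intervalIntegrable_iff] at h1 ⊢
    exact (Complex.conjCLE : ℂ →L[ℝ] ℂ).integrable_comp h1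
  · have h2 := congrArg (starRingEnd ℂ) (h x hx y hy).2
    rw [← intervalIntegral.intervalIntegral_conj] at h2
    rw [h2, map_sub]

theorem congr_left (h : IsPrimitiveOn I u w) (huv : EqOn u v I) :
    IsPrimitiveOn I v w := fun x hx y hy =>
  ⟨(h x hx y hy).1, by rw [(h x hx y hy).2, huv hx, huv hy]⟩

theorem congr_right (hI : I.OrdConnected) (h : IsPrimitiveOn I u w)
    (hwz : w =ᵐ[volume.restrict I] z) : IsPrimitiveOn I u z := fun x hx y hy => by
  have hsub : uIoc x y ⊆ I := uIoc_subset_uIcc.trans (hI.uIcc_subset hx hy)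
  have he : w =ᵐ[volume.restrict (uIoc x y)] z := ae_restrict_of_ae_restrict_of_subset hsub hwz
  refine ⟨?_, ?_⟩
  · have h1 := (h x hx y hy).1
    rw [intervalIntegrable_iff] at h1 ⊢
    exact h1.congr he
  · rw [← (h x hx y hy).2]
    refine intervalIntegral.integral_congr_ae ?_
    rw [Filter.EventuallyEq, ae_restrict_iff' measurableSet_uIoc] at he
    filter_upwards [he] with t ht hts using (ht hts).symm

theorem continuousOn_uIcc (hI : I.OrdConnected) (h : IsPrimitiveOn I u w) {x y : ℝ} (hx : x ∈ I)
    (hy : y ∈ I) : ContinuousOn u (uIcc x y) := by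
  have h1 := (h x hx y hy).1
  rw [intervalIntegrable_iff'] at h1
  have h2 := (intervalIntegral.continuousOn_primitive_interval (a := x) (b := y)
    (f := w) (μ := volume) h1).add (continuousOn_const (c := u x))
  refine h2.congr fun t ht => ?_
  rw [Pi.add_apply, (h x hx t (hI.uIcc_subset hx hy ht)).2]
  ring

theorem continuousOn (hI : I.OrdConnected) (hIo : IsOpen I) (h : IsPrimitiveOn I u w) :
    ContinuousOn u I := fun x hx => by
  obtain ⟨ε, hε, hb⟩ := Metric.isOpen_iff.1 hIo x hx
  have h1 : x - ε / 2 ∈ I := hb (by simp [abs_of_pos hε, hε])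
  have h2 : x + ε / 2 ∈ I := hb (by simp [abs_of_pos hε, hε])
  have h3 := h.continuousOn_uIcc hI h1 h2
  rw [uIcc_of_le (by linarith)] at h3
  exact (h3.continuousAt (Icc_mem_nhds (by linarith) (by linarith))).continuousWithinAt

theorem _root_.AbsolutelyContinuousOnInterval.congr {X : Type*} [PseudoMetricSpace X]
    {f g : ℝ → X} {a b : ℝ} (hf : AbsolutelyContinuousOnInterval f a b)
    (h : EqOn f g (uIcc a b)) : AbsolutelyContinuousOnInterval g a b := by
  refine Tendsto.congr' ?_ hf
  filter_upwards [mem_inf_of_right (mem_principal_self _)] with E hE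
  refine Finset.sum_congr rfl fun i hi => ?_
  rw [h (hE.1 i hi).1, h (hE.1 i hi).2]

/-- Reduction to the real-valued case: the real and imaginary parts are treated separately and
recombined as `re • 1 + im • I`. -/
theorem _root_.IntervalIntegrable.absolutelyContinuousOnInterval_integral {w : ℝ → ℂ} {x y : ℝ}
    (h : IntervalIntegrable w volume x y) :
    AbsolutelyContinuousOnInterval (fun t => ∫ s in x..t, w s) x y := by
  have hre : IntervalIntegrable (fun t => (w t).re) volume x y := by
    rw [intervalIntegrable_iff] at h ⊢; exact h.re
  have him : IntervalIntegrable (fun t => (w t).im) volume x y := by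
    rw [intervalIntegrable_iff] at h ⊢; exact h.im
  have h1 := hre.absolutelyContinuousOnInterval_intervalIntegral (c := x) (by simp)
  have h2 := him.absolutelyContinuousOnInterval_intervalIntegral (c := x) (by simp)
  have hc : ∀ z : ℂ, AbsolutelyContinuousOnInterval (fun _ => z) x y := fun z =>
    (LipschitzWith.const (α := ℝ) z).lipschitzOnWith.absolutelyContinuousOnInterval
  have h3 : AbsolutelyContinuousOnInterval (fun t => (∫ s in x..t, (w s).re) • (1 : ℂ) +
    (∫ s in x..t, (w s).im) • Complex.I) x y := (h1.smul (hc 1)).add (h2.smul (hc Complex.I))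
  refine h3.congr fun t ht => ?_
  have hsub : uIcc x t ⊆ uIcc x y := uIcc_subset_uIcc_left ht
  have hr : IntervalIntegrable (fun t => ((w t).re : ℂ)) volume x t :=
    IntervalIntegrable.mono_set (by
      rw [intervalIntegrable_iff] at hre ⊢; exact hre.ofReal) hsub
  have hi : IntervalIntegrable (fun t => ((w t).im : ℂ)) volume x t :=
    IntervalIntegrable.mono_set (by
      rw [intervalIntegrable_iff] at him ⊢; exact him.ofReal) hsub
  simp only [Complex.real_smul, mul_one, ← intervalIntegral.integral_ofReal]
  rw [← intervalIntegral.integral_mul_const, ← intervalIntegral.integral_add hr (hi.mul_const _)]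
  exact intervalIntegral.integral_congr fun s _ => Complex.re_add_im (w s)

/-- The difference between the product of the two primitives and the integral of `w v + u z` is
absolutely continuous with derivative zero almost everywhere, hence constant. Comparing its values
at `x` and `y` gives the product rule without any continuity of `w` or `z`. -/
theorem mul (hI : I.OrdConnected) (h : IsPrimitiveOn I u w) (h' : IsPrimitiveOn I v z) :
    IsPrimitiveOn I (fun x => u x * v x) (fun x => w x * v x + u x * z x) := fun x hx y hy => by
  have hint : IntervalIntegrable (fun x => w x * v x + u x * z x) volume x y :=
    ((h x hx y hy).1.mul_continuousOn (h'.continuousOn_uIcc hI hx hy)).add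
      ((h' x hx y hy).1.continuousOn_mul (h.continuousOn_uIcc hI hx hy))
  refine ⟨hint, ?_⟩
  have hc : ∀ c : ℂ, AbsolutelyContinuousOnInterval (fun _ => c) x y := fun c =>
    (LipschitzWith.const (α := ℝ) c).lipschitzOnWith.absolutelyContinuousOnInterval
  have hac : AbsolutelyContinuousOnInterval (fun t => (u x + ∫ s in x..t, w s) *
      (v x + ∫ s in x..t, z s) - ∫ s in x..t, w s * v s + u s * z s) x y :=
    (((hc (u x)).add (h x hx y hy).1.absolutelyContinuousOnInterval_integral).smul
      ((hc (v x)).add (h' x hx y hy).1.absolutelyContinuousOnInterval_integral)).sub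
      hint.absolutelyContinuousOnInterval_integral
  have hu : ∀ t ∈ uIcc x y, u t = u x + ∫ s in x..t, w s := fun t ht => by
    rw [(h x hx t (hI.uIcc_subset hx hy ht)).2]; ring
  have hv : ∀ t ∈ uIcc x y, v t = v x + ∫ s in x..t, z s := fun t ht => by
    rw [(h' x hx t (hI.uIcc_subset hx hy ht)).2]; ring
  obtain ⟨C, hC⟩ := hac.const_of_ae_hasDerivAt_zero (by
    filter_upwards [(h x hx y hy).1.ae_hasDerivAt_integral,
      (h' x hx y hy).1.ae_hasDerivAt_integral, hint.ae_hasDerivAt_integral] with t h1 h2 h3 ht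
    have := (((h1 ht x (by simp)).const_add (u x)).mul
      ((h2 ht x (by simp)).const_add (v x))).sub (h3 ht x (by simp))
    rw [← hu t ht, ← hv t ht, sub_self] at this
    exact this)
  have e1 := hC x (by simp)
  have e2 := hC y (by simp)
  rw [← hu x (by simp), ← hv x (by simp), intervalIntegral.integral_same] at e1
  rw [← hu y (by simp), ← hv y (by simp), ← e1] at e2
  linear_combination -e2

theorem of_contDiff {φ : ℝ → ℂ} (hφ : ContDiff ℝ ∞ φ) : IsPrimitiveOn I φ (deriv φ) :=
  fun x _ y _ => by
  have hc : Continuous (deriv φ) := hφ.continuous_deriv (by simp)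
  refine ⟨hc.intervalIntegrable _ _, ?_⟩
  exact intervalIntegral.integral_deriv_eq_sub
    (fun t _ => (hφ.differentiable (by simp)).differentiableAt) (hc.intervalIntegrable _ _)

theorem integral (hI : I.OrdConnected) (hw : LocallyIntegrableOn w I) {x₀ : ℝ} (hx₀ : x₀ ∈ I) :
    IsPrimitiveOn I (fun x => ∫ t in x₀..x, w t) w := fun x hx y hy => by
  have hint : ∀ a ∈ I, ∀ b ∈ I, IntervalIntegrable w volume a b := fun a ha b hb => by
    rw [intervalIntegrable_iff']
    exact hw.integrableOn_compact_subset (hI.uIcc_subset ha hb) isCompact_uIcc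
  refine ⟨hint x hx y hy, ?_⟩
  rw [eq_sub_iff_add_eq, add_comm, intervalIntegral.integral_add_adjacent_intervals
    (hint _ hx₀ _ hx) (hint _ hx _ hy)]

end IsPrimitiveOn

/-! ### Test functions and the du Bois-Reymond lemma -/

/-- Real-valued test functions supported in `I`. -/
structure IsTestOn (I : Set ℝ) (φ : ℝ → ℝ) : Prop where
  contDiff : ContDiff ℝ ∞ φ
  hasCompactSupport : HasCompactSupport φ
  tsupport_subset : tsupport φ ⊆ I

namespace IsTestOn

variable {I : Set ℝ} {φ ψ : ℝ → ℝ} {u w f : ℝ → ℂ}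

theorem deriv (h : IsTestOn I φ) : IsTestOn I (deriv φ) where
  contDiff := (contDiff_infty_iff_deriv.1 h.contDiff).2
  hasCompactSupport := h.hasCompactSupport.deriv
  tsupport_subset := (closure_minimal support_deriv_subset isClosed_closure).trans
    h.tsupport_subset

theorem sub_const_mul (h : IsTestOn I φ) (h' : IsTestOn I ψ) (c : ℝ) :
    IsTestOn I (fun x => φ x - c * ψ x) where
  contDiff := h.contDiff.sub (contDiff_const.mul h'.contDiff)
  hasCompactSupport := h.hasCompactSupport.sub h'.hasCompactSupport.mul_left
  tsupport_subset := (tsupport_sub _ _).trans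
    (union_subset h.tsupport_subset (tsupport_mul_subset_right.trans h'.tsupport_subset))

theorem deriv_sub_const_mul (h : IsTestOn I φ) (h' : IsTestOn I ψ) (c : ℝ) :
    _root_.deriv (fun x => φ x - c * ψ x) = fun x => _root_.deriv φ x - c * _root_.deriv ψ x := by
  funext x
  have h1 := (h.contDiff.differentiable (by simp)).differentiableAt (x := x)
  have h2 := (h'.contDiff.differentiable (by simp)).differentiableAt (x := x)
  rw [deriv_fun_sub h1 (h2.const_mul c), deriv_const_mul _ h2]

theorem eq_zero (h : IsTestOn I φ) {x : ℝ} (hx : x ∉ I) : φ x = 0 :=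
  image_eq_zero_of_notMem_tsupport fun hx' => hx (h.tsupport_subset hx')

theorem integrableOn_smul (h : IsTestOn I φ) (hu : LocallyIntegrableOn u I) :
    IntegrableOn (fun x => φ x • u x) I := by
  have hK : IntegrableOn (fun x => φ x • u x) (tsupport φ) :=
    (hu.integrableOn_compact_subset h.tsupport_subset h.hasCompactSupport).continuousOn_smul
      h.contDiff.continuous.continuousOn h.hasCompactSupport
  exact ((integrableOn_iff_integrable_of_support_subset fun x hx =>
    subset_tsupport φ (left_ne_zero_of_smul hx)).1 hK).integrableOn

theorem integral_sub_const_mul_smul (h : IsTestOn I φ) (h' : IsTestOn I ψ)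
    (hu : LocallyIntegrableOn u I) (c : ℝ) :
    ∫ x in I, (φ x - c * ψ x) • u x = (∫ x in I, φ x • u x) - c * ∫ x in I, ψ x • u x := by
  have h2 : IntegrableOn (fun x => c • ψ x • u x) I := (h'.integrableOn_smul hu).smul c
  simp only [sub_smul, mul_smul]
  rw [integral_sub (h.integrableOn_smul hu) h2, integral_smul, Complex.real_smul]

theorem exists_Ioo (h : IsTestOn I φ) (hIo : IsOpen I)
    (hne : I.Nonempty) : ∃ m ∈ I, ∃ M ∈ I, m < M ∧ tsupport φ ⊆ Ioo m M := by
  obtain ⟨x₀, hx₀⟩ := hne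
  -- Inserting `x₀` keeps the compact set nonempty even when `φ = 0`, so that a least and a greatest
  -- element exist.
  have hK : IsCompact (insert x₀ (tsupport φ)) := h.hasCompactSupport.isCompact.insert x₀
  have hKI : insert x₀ (tsupport φ) ⊆ I := insert_subset hx₀ h.tsupport_subset
  obtain ⟨m, hm, hm'⟩ := hK.exists_isLeast (insert_nonempty _ _)
  obtain ⟨M, hM, hM'⟩ := hK.exists_isGreatest (insert_nonempty _ _)
  obtain ⟨ε, hε, hb⟩ := Metric.isOpen_iff.1 hIo m (hKI hm)
  obtain ⟨δ, hδ, hb'⟩ := Metric.isOpen_iff.1 hIo M (hKI hM)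
  have hmM : m ≤ M := hm' hM
  refine ⟨m - ε / 2, hb (by simp [abs_of_pos hε, hε]), M + δ / 2,
    hb' (by simp [abs_of_pos hδ, hδ]), by linarith, fun x hx => ?_⟩
  have h1 := hm' (mem_insert_of_mem x₀ hx)
  have h2 := hM' (mem_insert_of_mem x₀ hx)
  exact ⟨by linarith, by linarith⟩

theorem exists_integral_eq_one (hIo : IsOpen I) (hne : I.Nonempty) :
    ∃ ρ : ℝ → ℝ, IsTestOn I ρ ∧ ∫ x, ρ x = 1 := by
  obtain ⟨x₀, hx₀⟩ := hne
  obtain ⟨ε, hε, hb⟩ := Metric.isOpen_iff.1 hIo x₀ hx₀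
  let b : ContDiffBump x₀ := ⟨ε / 4, ε / 2, by linarith, by linarith⟩
  refine ⟨b.normed volume, ⟨b.contDiff_normed, b.hasCompactSupport_normed, ?_⟩, b.integral_normed⟩
  rw [b.tsupport_normed_eq]
  exact (Metric.closedBall_subset_ball (by change ε / 2 < ε; linarith)).trans hb

/-- The primitive starting left of the support of `φ` vanishes to the left trivially, and to the
right because the total integral is zero. -/
theorem exists_deriv_eq (h : IsTestOn I φ) (hI : I.OrdConnected) (hIo : IsOpen I)
    (hne : I.Nonempty) (h0 : ∫ x, φ x = 0) : ∃ χ, IsTestOn I χ ∧ _root_.deriv χ = φ := by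
  obtain ⟨m, hm, M, hM, hmM, hsub⟩ := h.exists_Ioo hIo hne
  have hc := h.contDiff.continuous
  have hd : ∀ x, HasDerivAt (fun x => ∫ t in m..x, φ t) (φ x) x := fun x =>
    intervalIntegral.integral_hasDerivAt_right (hc.intervalIntegrable _ _)
      (hc.stronglyMeasurableAtFilter _ _) hc.continuousAt
  have hderiv : _root_.deriv (fun x => ∫ t in m..x, φ t) = φ := funext fun x => (hd x).deriv
  have hz : ∀ x ∉ Ioo m M, φ x = 0 := fun x hx =>
    image_eq_zero_of_notMem_tsupport fun hx' => hx (hsub hx')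
  have hsupp : Function.support (fun x => ∫ t in m..x, φ t) ⊆ Icc m M := by
    intro x hx
    by_contra hx'
    refine hx ?_
    rcases lt_or_ge x m with hxm | hxm
    · change ∫ t in m..x, φ t = 0
      rw [intervalIntegral.integral_symm, neg_eq_zero]
      refine intervalIntegral.integral_zero_ae (ae_of_all _ fun t ht => hz t fun h' => ?_)
      rw [uIoc_of_le hxm.le] at ht
      exact absurd h'.1 (not_lt.2 ht.2)
    · have hMx : M < x := by
        by_contra h'
        exact hx' ⟨hxm, not_lt.1 h'⟩
      change ∫ t in m..x, φ t = 0
      rw [intervalIntegral.integral_of_le hxm, ← h0]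
      refine setIntegral_eq_integral_of_forall_compl_eq_zero fun t ht => hz t fun h' => ?_
      exact ht ⟨h'.1, (h'.2.trans hMx).le⟩
  have hts := closure_minimal hsupp isClosed_Icc
  refine ⟨_, ⟨?_, isCompact_Icc.of_isClosed_subset isClosed_closure hts,
    hts.trans (hI.out hm hM)⟩, hderiv⟩
  rw [contDiff_infty_iff_deriv, hderiv]
  exact ⟨fun x => (hd x).differentiableAt, h.contDiff⟩

/-- With `∫ ρ = 1`, the function `φ - (∫ φ) ρ` has integral zero and so is the derivative of a test
function; therefore `Λ φ = (∫ φ) Λ ρ`, and the constant is `Λ ρ`. An abstract `Λ` allows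
distributions such as `α w'' + β w - F`, not only functions. -/
theorem exists_const_of_forall_deriv_eq_zero (hI : I.OrdConnected) (hIo : IsOpen I)
    (hne : I.Nonempty) (Λ : (ℝ → ℝ) → ℂ)
    (hΛ : ∀ φ ψ, IsTestOn I φ → IsTestOn I ψ → ∀ c : ℝ,
      Λ (fun x => φ x - c * ψ x) = Λ φ - c * Λ ψ)
    (h0 : ∀ φ, IsTestOn I φ → Λ (_root_.deriv φ) = 0) :
    ∃ C : ℂ, ∀ φ, IsTestOn I φ → Λ φ = ∫ x in I, φ x • C := by
  obtain ⟨ρ, hρ, hρ1⟩ := exists_integral_eq_one hIo hne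
  refine ⟨Λ ρ, fun φ hφ => ?_⟩
  have hi : ∀ {φ : ℝ → ℝ}, IsTestOn I φ → Integrable φ := fun h =>
    h.contDiff.continuous.integrable_of_hasCompactSupport h.hasCompactSupport
  obtain ⟨χ, hχ, hχ'⟩ := (hφ.sub_const_mul hρ (∫ x, φ x)).exists_deriv_eq hI hIo hne (by
    rw [integral_sub (hi hφ) ((hi hρ).const_mul _), integral_const_mul, hρ1]; ring)
  have h1 := h0 χ hχ
  rw [hχ', hΛ φ ρ hφ hρ] at h1
  rw [integral_smul_const, setIntegral_eq_integral_of_forall_compl_eq_zero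
    fun x hx => hφ.eq_zero hx, Complex.real_smul]
  linear_combination h1

end IsTestOn

/-! ### Weak derivatives and regularity of weak solutions -/

section Weak

variable {I : Set ℝ} {u w f : ℝ → ℂ}

/-- The product rule for `φ u` between two points of `I` outside the support of `φ`, where the
boundary terms vanish. -/
theorem IsPrimitiveOn.hasWeakDerivOn (hI : I.OrdConnected) (hIo : IsOpen I)
    (hw : LocallyIntegrableOn w I) (h : IsPrimitiveOn I u w) : HasWeakDerivOn I u w := by
  intro φ hφ hc hs
  have hT : IsTestOn I φ := ⟨hφ, hc, hs⟩
  rcases I.eq_empty_or_nonempty with rfl | hne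
  · simp
  have hu : LocallyIntegrableOn u I :=
    (h.continuousOn hI hIo).locallyIntegrableOn hIo.measurableSet
  obtain ⟨m, hm, M, hM, hmM, hsub⟩ := hT.exists_Ioo hIo hne
  have hz : ∀ x ∉ Ioo m M, φ x = 0 := fun x hx =>
    image_eq_zero_of_notMem_tsupport fun hx' => hx (hsub hx')
  have hz' : ∀ x ∉ Ioo m M, deriv φ x = 0 := fun x hx =>
    image_eq_zero_of_notMem_tsupport fun hx' => hx (hsub
      (closure_minimal support_deriv_subset isClosed_closure hx'))
  have hderiv : ∀ x, deriv (fun x => (φ x : ℂ)) x = ((deriv φ x : ℝ) : ℂ) := fun x =>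
    ((hφ.differentiable (by simp)).differentiableAt (x := x)).hasDerivAt.ofReal_comp.deriv
  have hφc : ContDiff ℝ ∞ (fun x => (φ x : ℂ)) := Complex.ofRealCLM.contDiff.comp hφ
  have hp := (((IsPrimitiveOn.of_contDiff (I := I) hφc).mul hI h) m hm M hM).2
  rw [eq_neg_iff_add_eq_zero, ← integral_add (hT.deriv.integrableOn_smul hu)
    (hT.integrableOn_smul hw)]
  beta_reduce at hp
  rw [hz m (by simp), hz M (by simp), intervalIntegral.integral_of_le hmM.le] at hp
  rw [setIntegral_eq_of_subset_of_forall_sdiff_eq_zero hIo.measurableSet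
    (Ioc_subset_Icc_self.trans (hI.out hm hM)) (fun x hx => ?_)]
  · simpa [hderiv] using hp
  · have hx' : x ∉ Ioo m M := fun h' => hx.2 ⟨h'.1, h'.2.le⟩
    simp [hz x hx', hz' x hx']

theorem ae_eq_of_forall_integral_smul_eq (hIo : IsOpen I) (hu : LocallyIntegrableOn u I)
    (hw : LocallyIntegrableOn w I)
    (h : ∀ φ, IsTestOn I φ → ∫ x in I, φ x • u x = ∫ x in I, φ x • w x) :
    u =ᵐ[volume.restrict I] w := by
  have h1 := hIo.ae_eq_zero_of_integral_contDiff_smul_eq_zero (μ := volume) (hu.sub hw)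
    fun φ hφ hc hs => by
      have hT : IsTestOn I φ := ⟨hφ, hc, hs⟩
      rw [← setIntegral_eq_integral_of_forall_compl_eq_zero (s := I)
        fun x hx => by rw [hT.eq_zero hx, zero_smul]]
      simp only [Pi.sub_apply, smul_sub]
      rw [integral_sub (hT.integrableOn_smul hu) (hT.integrableOn_smul hw), h φ hT, sub_self]
  rw [Filter.EventuallyEq, ae_restrict_iff' hIo.measurableSet]
  filter_upwards [h1] with x hx hxI using sub_eq_zero.1 (hx hxI)

/-- A locally integrable function with a locally integrable weak derivative is almost everywhere
equal to a primitive of it. -/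
theorem HasWeakDerivOn.exists_isPrimitiveOn (hI : I.OrdConnected) (hIo : IsOpen I)
    (hu : LocallyIntegrableOn u I) (hw : LocallyIntegrableOn w I) (h : HasWeakDerivOn I u w) :
    ∃ g, IsPrimitiveOn I g w ∧ u =ᵐ[volume.restrict I] g := by
  rcases I.eq_empty_or_nonempty with rfl | ⟨x₀, hx₀⟩
  · exact ⟨u, fun x hx => hx.elim, by simp⟩
  have hp := IsPrimitiveOn.integral hI hw hx₀
  set F := fun x => ∫ t in x₀..x, w t
  have hF : LocallyIntegrableOn F I :=
    (hp.continuousOn hI hIo).locallyIntegrableOn hIo.measurableSet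
  have hFw := hp.hasWeakDerivOn hI hIo hw
  have huF := hu.sub hF
  -- Testing against `u - F` kills derivatives, because `u` and `F` have the same weak derivative
  -- `w`.
  obtain ⟨C, hC⟩ := IsTestOn.exists_const_of_forall_deriv_eq_zero hI hIo ⟨x₀, hx₀⟩
    (fun φ => ∫ x in I, φ x • (u - F) x) (fun φ ψ hφ hψ c => by
      exact hφ.integral_sub_const_mul_smul hψ huF c)
    (fun φ hφ => by
      simp only [Pi.sub_apply, smul_sub]
      rw [integral_sub (hφ.deriv.integrableOn_smul hu) (hφ.deriv.integrableOn_smul hF),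
        h φ hφ.1 hφ.2 hφ.3, hFw φ hφ.1 hφ.2 hφ.3, sub_self])
  refine ⟨fun x => F x + C, hp.add_const C, ?_⟩
  filter_upwards [ae_eq_of_forall_integral_smul_eq (w := fun _ => C) hIo huF
    ((locallyIntegrable_const C).locallyIntegrableOn I) hC] with x hx
  rw [Pi.sub_apply] at hx
  linear_combination hx

/-- Regularity of distributional solutions of `α w''' + β w' = f`. -/
theorem exists_isPrimitiveOn_of_weak_eq (hI : I.OrdConnected) (hIo : IsOpen I)
    (hw : LocallyIntegrableOn w I) (hf : LocallyIntegrableOn f I) {α β : ℝ} (hα : α ≠ 0)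
    (h : ∀ φ, IsTestOn I φ → ∫ x in I, (α * deriv (deriv (deriv φ)) x + β * deriv φ x) • w x =
      -∫ x in I, φ x • f x) :
    ∃ g₀ g₁ g₂ : ℝ → ℂ, w =ᵐ[volume.restrict I] g₀ ∧ IsPrimitiveOn I g₀ g₁ ∧
      IsPrimitiveOn I g₁ g₂ ∧ IsPrimitiveOn I g₂ (fun x => (α : ℂ)⁻¹ * (f x - β * g₁ x)) := by
  rcases I.eq_empty_or_nonempty with rfl | hne
  · exact ⟨w, w, w, by simp, fun x hx => hx.elim, fun x hx => hx.elim, fun x hx => hx.elim⟩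
  obtain ⟨x₀, hx₀⟩ := id hne
  have hαc : (α : ℂ) ≠ 0 := by exact_mod_cast hα
  have hp := IsPrimitiveOn.integral hI hf hx₀
  set F := fun x => ∫ t in x₀..x, f t
  have hF : LocallyIntegrableOn F I :=
    (hp.continuousOn hI hIo).locallyIntegrableOn hIo.measurableSet
  have hFf := hp.hasWeakDerivOn hI hIo hf
  -- First integration of the equation: the distribution `α w'' + β w - F` has derivative zero, so
  -- it is a constant `C`. Then `S` below is the weak second derivative of `w`.
  obtain ⟨C, hC⟩ := IsTestOn.exists_const_of_forall_deriv_eq_zero hI hIo hne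
    (fun φ => α • (∫ x in I, deriv (deriv φ) x • w x) + β • (∫ x in I, φ x • w x)
      - ∫ x in I, φ x • F x) (fun φ ψ hφ hψ c => by
      simp only [hφ.deriv_sub_const_mul hψ, hφ.deriv.deriv_sub_const_mul hψ.deriv]
      rw [hφ.integral_sub_const_mul_smul hψ hw, hφ.integral_sub_const_mul_smul hψ hF,
        hφ.deriv.deriv.integral_sub_const_mul_smul hψ.deriv.deriv hw]
      simp only [Complex.real_smul]
      ring)
    (fun φ hφ => by
      have h1 := h φ hφ
      simp only [add_smul, mul_smul] at h1
      have i1 : IntegrableOn (fun x => α • deriv (deriv (deriv φ)) x • w x) I :=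
        (hφ.deriv.deriv.deriv.integrableOn_smul hw).smul α
      have i2 : IntegrableOn (fun x => β • deriv φ x • w x) I :=
        (hφ.deriv.integrableOn_smul hw).smul β
      rw [integral_add i1 i2, integral_smul, integral_smul] at h1
      rw [h1, hFf φ hφ.1 hφ.2 hφ.3, sub_self])
  set S : ℝ → ℂ := fun x => (α : ℂ)⁻¹ * (F x + C - β * w x) with hS
  have hSl : LocallyIntegrableOn S I := by
    have h1 := ((hF.add ((locallyIntegrable_const C).locallyIntegrableOn I)).sub
      (hw.smul (β : ℂ))).smul (α : ℂ)⁻¹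
    exact h1
  have hSw : ∀ φ, IsTestOn I φ → ∫ x in I, deriv (deriv φ) x • w x = ∫ x in I, φ x • S x := by
    intro φ hφ
    have h1 := hC φ hφ
    have e : ∀ x, φ x • S x = (α : ℂ)⁻¹ * (φ x • F x + φ x • C - β * (φ x • w x)) := fun x => by
      simp only [hS, Complex.real_smul]; ring
    have i1 := hφ.integrableOn_smul hF
    have i2 := hφ.integrableOn_smul ((locallyIntegrable_const C).locallyIntegrableOn I)
    have i3 := hφ.integrableOn_smul hw
    simp only [e]
    have i4 : IntegrableOn (fun x => φ x • F x + φ x • C) I := i1.add i2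
    rw [integral_const_mul, integral_sub i4 (i3.const_mul _), integral_add i1 i2,
      integral_const_mul, ← h1]
    simp only [Complex.real_smul]
    field_simp
    ring
  have hpS := IsPrimitiveOn.integral hI hSl hx₀
  set P := fun x => ∫ t in x₀..x, S t
  have hP : LocallyIntegrableOn P I :=
    (hpS.continuousOn hI hIo).locallyIntegrableOn hIo.measurableSet
  have hPS := hpS.hasWeakDerivOn hI hIo hSl
  -- Second integration: `P` is a primitive of `S = w''`, so the distribution `P - w'` is a constant
  -- `C'`.
  obtain ⟨C', hC'⟩ := IsTestOn.exists_const_of_forall_deriv_eq_zero hI hIo hne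
    (fun φ => (∫ x in I, deriv φ x • w x) + ∫ x in I, φ x • P x) (fun φ ψ hφ hψ c => by
      simp only [hφ.deriv_sub_const_mul hψ]
      rw [hφ.integral_sub_const_mul_smul hψ hP,
        hφ.deriv.integral_sub_const_mul_smul hψ.deriv hw]
      ring)
    (fun φ hφ => by rw [hSw φ hφ, hPS φ hφ.1 hφ.2 hφ.3, add_neg_cancel])
  have hP' : LocallyIntegrableOn (fun x => P x + -C') I :=
    hP.add ((locallyIntegrable_const (-C')).locallyIntegrableOn I)
  have hwP : HasWeakDerivOn I w (fun x => P x + -C') := fun φ hφ hc hs => by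
    have hT : IsTestOn I φ := ⟨hφ, hc, hs⟩
    have h1 := hC' φ hT
    simp only [smul_add, smul_neg]
    have i1 : IntegrableOn (fun x => -(φ x • C')) I :=
      (hT.integrableOn_smul ((locallyIntegrable_const C').locallyIntegrableOn I)).neg
    rw [integral_add (hT.integrableOn_smul hP) i1, integral_neg, ← h1]
    ring
  obtain ⟨g, hg, hwg⟩ := hwP.exists_isPrimitiveOn hI hIo hw hP'
  -- The second derivative is `S` with `w` replaced by its continuous representative `g`, which
  -- makes it a genuine primitive and not only an almost everywhere one.
  refine ⟨g, fun x => P x + -C', fun x => (α : ℂ)⁻¹ * (F x + C + (-β : ℂ) * g x), hwg, hg,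
    (hpS.add_const _).congr_right hI ?_,
    (((hp.add_const C).add (hg.const_mul (-β : ℂ))).const_mul (α : ℂ)⁻¹).congr_right hI
      (ae_of_all _ fun x => by ring)⟩
  filter_upwards [hwg] with x hx
  simp only [hS, hx]
  ring

end Weak

/-! ### Jets and Green's formula on an interval -/

/-- `u = (u₀, u₁, u₂, u₃)` with `uₖ` a primitive of `uₖ₊₁` on `I`. -/
def IsJetOn (I : Set ℝ) (u : Fin 4 → ℝ → ℂ) : Prop :=
  ∀ k : Fin 3, IsPrimitiveOn I (u k.castSucc) (u k.succ)

/-- The bilinear boundary form of `α ∂³ + β ∂`. -/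
def greenForm (α β : ℂ) (p q : Fin 3 → ℂ) : ℂ :=
  α * (p 2 * q 0 - p 1 * q 1 + p 0 * q 2) + β * (p 0 * q 0)

theorem ContDiff.iteratedDeriv_infty {φ : ℝ → ℂ} (hφ : ContDiff ℝ ∞ φ) (k : ℕ) :
    ContDiff ℝ ∞ (iteratedDeriv k φ) := by
  rw [iteratedDeriv_eq_iterate]
  exact hφ.iterate_deriv k

namespace IsJetOn

variable {I : Set ℝ} {u v : Fin 4 → ℝ → ℂ}

theorem of_contDiff {φ : ℝ → ℂ} (hφ : ContDiff ℝ ∞ φ) :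
    IsJetOn I (fun k => iteratedDeriv k φ) := fun k => by
  have h := IsPrimitiveOn.of_contDiff (I := I) (hφ.iteratedDeriv_infty k)
  rw [← iteratedDeriv_succ] at h
  exact h

theorem conj (h : IsJetOn I u) : IsJetOn I (fun k x => starRingEnd ℂ (u k x)) :=
  fun k => (h k).conj

/-- Product rule applied to `u₂v₀ - u₁v₁ + u₀v₂`: the mixed terms `u₂v₁` and `u₁v₂` cancel, which is
why the middle term carries a minus sign. -/
theorem green (hI : I.OrdConnected) (hu : IsJetOn I u) (hv : IsJetOn I v) (α β : ℂ) :
    IsPrimitiveOn I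
      (fun x => greenForm α β (fun k => u k.castSucc x) (fun k => v k.castSucc x))
      (fun x => (α * u 3 x + β * u 1 x) * v 0 x + u 0 x * (α * v 3 x + β * v 1 x)) := by
  have h1 := ((((hu 2).mul hI (hv 0)).add (((hu 1).mul hI (hv 1)).const_mul (-1))).add
    ((hu 0).mul hI (hv 2))).const_mul α
  have h2 := ((hu 0).mul hI (hv 0)).const_mul β
  refine ((h1.add h2).congr_left fun x _ => ?_).congr_right hI (ae_of_all _ fun x => ?_)
  · simp only [greenForm]
    ring
  · change α * _ + β * _ = _
    simp only [Fin.isValue, Fin.reduceCastSucc, Fin.reduceSucc, Fin.castSucc_zero,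
      Fin.succ_zero_eq_one, Fin.castSucc_one, Fin.succ_one_eq_two]
    ring

end IsJetOn

/-! ### Cutoffs and uniform pointwise estimates -/

/-- Smooth functions supported near `0` with prescribed two-jet at `0`. -/
theorem exists_cutoff {h : ℝ} (hh : 0 < h) : ∃ η : Fin 3 → ℝ → ℂ, (∀ j, ContDiff ℝ ∞ (η j)) ∧
    (∀ j (k : ℕ) x, h ≤ |x| → iteratedDeriv k (η j) x = 0) ∧
    (∀ j k : Fin 3, iteratedDeriv k (η j) 0 = if j = k then 1 else 0) ∧
    ∃ M : ℝ, 0 ≤ M ∧ ∀ (j : Fin 3) (k : Fin 4) x, ‖iteratedDeriv k (η j) x‖ ≤ M := by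
  let b : ContDiffBump (0 : ℝ) := ⟨h / 4, h / 2, by linarith, by linarith⟩
  -- The factors `1 / j!`, so that `c j * x ^ j` has `j`-th derivative `1` at `0`.
  let c : Fin 3 → ℂ := ![1, 1, 2⁻¹]
  let η : Fin 3 → ℝ → ℂ := fun j x => c j * (x : ℂ) ^ (j : ℕ) * (b x : ℂ)
  have hsm : ∀ j, ContDiff ℝ ∞ (η j) := fun j =>
    (contDiff_const.mul (Complex.ofRealCLM.contDiff.pow _)).mul
      (Complex.ofRealCLM.contDiff.comp b.contDiff)
  have hz : ∀ j (k : ℕ) x, h ≤ |x| → iteratedDeriv k (η j) x = 0 := fun j k x hx => by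
    have he : η j =ᶠ[𝓝 x] fun _ => 0 := by
      have : {y : ℝ | h / 2 < |y|} ∈ 𝓝 x :=
        (isOpen_lt continuous_const continuous_abs).mem_nhds (by
          change h / 2 < |x|
          linarith)
      filter_upwards [this] with y hy
      have hb : b y = 0 := b.zero_of_le_dist (by
        rw [Real.dist_eq, sub_zero]; exact le_of_lt hy)
      simp [η, hb]
    rw [he.iteratedDeriv_eq, iteratedDeriv_const]
    simp
  refine ⟨η, hsm, hz, fun j k => ?_, ?_⟩
  · have he : η j =ᶠ[𝓝 0] fun x => c j * (x : ℂ) ^ (j : ℕ) := by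
      filter_upwards [b.eventuallyEq_one] with y hy
      simp [η, hy]
    have d1 : ∀ x : ℝ, HasDerivAt (fun x : ℝ => (x : ℂ)) 1 x := fun x =>
      Complex.ofRealCLM.hasDerivAt
    have e1 : deriv (fun x : ℝ => (x : ℂ)) = fun _ => 1 := funext fun x => (d1 x).deriv
    have e2 : deriv (fun x : ℝ => (x : ℂ) ^ 2) = fun x : ℝ => 2 * (x : ℂ) :=
      funext fun x => by
        have : deriv (fun x : ℝ => (x : ℂ) ^ 2) x = _ := ((d1 x).pow 2).deriv
        simpa using this
    rw [he.iteratedDeriv_eq]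
    fin_cases j <;> fin_cases k <;>
      simp [c, iteratedDeriv_succ, e1, e2]
  · have hc : Continuous fun x => ∑ j : Fin 3, ∑ k : Fin 4, ‖iteratedDeriv k (η j) x‖ :=
      continuous_finsetSum _ fun j _ => continuous_finsetSum _ fun k _ =>
        ((hsm j).iteratedDeriv_infty k).continuous.norm
    obtain ⟨M, hM⟩ := (isCompact_Icc (a := -h) (b := h)).exists_bound_of_continuousOn
      hc.continuousOn
    refine ⟨|M|, abs_nonneg M, fun j k x => ?_⟩
    rcases le_total h |x| with hx | hx
    · rw [hz j k x hx, norm_zero]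
      exact abs_nonneg M
    · have h1 := (le_abs_self _).trans (hM x (abs_le.1 hx))
      have h2 : ‖iteratedDeriv k (η j) x‖ ≤ ∑ k : Fin 4, ‖iteratedDeriv k (η j) x‖ :=
        Finset.single_le_sum (f := fun k : Fin 4 => ‖iteratedDeriv k (η j) x‖)
          (fun _ _ => norm_nonneg _) (Finset.mem_univ k)
      have h3 : ∑ k : Fin 4, ‖iteratedDeriv k (η j) x‖ ≤
          ∑ j : Fin 3, ∑ k : Fin 4, ‖iteratedDeriv k (η j) x‖ :=
        Finset.single_le_sum (f := fun j => ∑ k : Fin 4, ‖iteratedDeriv k (η j) x‖)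
          (fun _ _ => Finset.sum_nonneg fun _ _ => norm_nonneg _) (Finset.mem_univ j)
      exact (h2.trans h3).trans (h1.trans (le_abs_self M))

/-- Cauchy–Schwarz against the constant function `1`. -/
theorem lintegral_sq_le {μ : Measure ℝ} {s : ℝ → ℝ≥0∞} (hs : AEMeasurable s μ) :
    (∫⁻ x, s x ∂μ) ^ 2 ≤ μ univ * ∫⁻ x, s x ^ 2 ∂μ := by
  have h := ENNReal.lintegral_mul_le_Lp_mul_Lq μ Real.HolderConjugate.two_two
    (aemeasurable_const (b := (1 : ℝ≥0∞))) hs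
  simp only [Pi.mul_apply, one_mul, ENNReal.one_rpow, lintegral_one] at h
  have h2 := pow_le_pow_left' h 2
  rw [mul_pow, ← ENNReal.rpow_natCast, ← ENNReal.rpow_natCast, ← ENNReal.rpow_natCast,
    ← ENNReal.rpow_mul, ← ENNReal.rpow_mul] at h2
  norm_num at h2
  exact h2

theorem enorm_sq_le_of_norm_sq_le {z a b : ℂ} {K : ℝ} (hK : 0 ≤ K)
    (h : ‖z‖ ^ 2 ≤ K * (‖a‖ ^ 2 + ‖b‖ ^ 2)) :
    ‖z‖ₑ ^ 2 ≤ ENNReal.ofReal K * (‖a‖ₑ ^ 2 + ‖b‖ₑ ^ 2) := by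
  simp only [← ofReal_norm]
  rw [← ENNReal.ofReal_pow (norm_nonneg _), ← ENNReal.ofReal_pow (norm_nonneg _),
    ← ENNReal.ofReal_pow (norm_nonneg _), ← ENNReal.ofReal_add (by positivity) (by positivity),
    ← ENNReal.ofReal_mul hK]
  exact ENNReal.ofReal_le_ofReal h

/-- The boundary form is nondegenerate, uniformly in the coefficients: against the three unit
vectors it gives `α p₂ + β p₀`, `-α p₁` and `α p₀`, a triangular system for `p` solved with `α ≥ m`
and `|β| ≤ B`. The factor `3` comes from squaring a sum of three terms. -/
theorem norm_sq_le_of_greenForm {m B α β : ℝ} (hm : 0 < m) (hα : m ≤ α) (hβ : |β| ≤ B)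
    (p : Fin 3 → ℂ) (k : Fin 3) : ‖p k‖ ^ 2 ≤ 3 * (m⁻¹ + B * m⁻¹ ^ 2) ^ 2 *
      ∑ j : Fin 3, ‖greenForm α β p (Pi.single j 1)‖ ^ 2 := by
  have hα0 : 0 < α := hm.trans_le hα
  have hB : 0 ≤ B := (abs_nonneg β).trans hβ
  have hαn : ‖(α : ℂ)‖ = α := by simp [abs_of_pos hα0]
  have hβn : ‖(β : ℂ)‖ = |β| := by simp
  have e0 : greenForm α β p (Pi.single 0 1) = α * p 2 + β * p 0 := by simp [greenForm]
  have e1 : greenForm α β p (Pi.single 1 1) = -(α * p 1) := by simp [greenForm]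
  have e2 : greenForm α β p (Pi.single 2 1) = α * p 0 := by simp [greenForm]
  have key : ∀ z : ℂ, ‖z‖ ≤ m⁻¹ * ‖(α : ℂ) * z‖ := fun z => by
    rw [norm_mul, hαn, inv_mul_eq_div, le_div_iff₀ hm, mul_comm]
    exact mul_le_mul_of_nonneg_right hα (norm_nonneg _)
  have k0 := key (p 0)
  have k1 := key (p 1)
  have k2 := key (p 2)
  rw [Fin.sum_univ_three, e0, e1, e2, norm_neg]
  set x := ‖(α : ℂ) * p 2 + β * p 0‖
  set y := ‖(α : ℂ) * p 1‖
  set z := ‖(α : ℂ) * p 0‖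
  have h2 : ‖(α : ℂ) * p 2‖ ≤ x + B * (m⁻¹ * z) := by
    have : (α : ℂ) * p 2 = (α * p 2 + β * p 0) - β * p 0 := by ring
    rw [this]
    refine (norm_sub_le _ _).trans (add_le_add le_rfl ?_)
    rw [norm_mul, hβn]
    exact mul_le_mul hβ k0 (norm_nonneg _) hB
  have hx : 0 ≤ x := norm_nonneg _
  have hy : 0 ≤ y := norm_nonneg _
  have hz : 0 ≤ z := norm_nonneg _
  have hmi : 0 < m⁻¹ := inv_pos.2 hm
  have hK : ‖p k‖ ≤ (m⁻¹ + B * m⁻¹ ^ 2) * (x + y + z) := by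
    have h3 : m⁻¹ * ‖(α : ℂ) * p 2‖ ≤ m⁻¹ * (x + B * (m⁻¹ * z)) :=
      mul_le_mul_of_nonneg_left h2 hmi.le
    have q1 : 0 ≤ m⁻¹ * x := by positivity
    have q2 : 0 ≤ m⁻¹ * y := by positivity
    have q3 : 0 ≤ m⁻¹ * z := by positivity
    have q4 : 0 ≤ B * m⁻¹ ^ 2 * x := by positivity
    have q5 : 0 ≤ B * m⁻¹ ^ 2 * y := by positivity
    have q6 : 0 ≤ B * m⁻¹ ^ 2 * z := by positivity
    fin_cases k <;> simp only [Fin.zero_eta, Fin.mk_one, Fin.reduceFinMk] <;> linarith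
  calc ‖p k‖ ^ 2 ≤ ((m⁻¹ + B * m⁻¹ ^ 2) * (x + y + z)) ^ 2 :=
        pow_le_pow_left₀ (norm_nonneg _) hK 2
    _ = (m⁻¹ + B * m⁻¹ ^ 2) ^ 2 * (x + y + z) ^ 2 := by ring
    _ ≤ (m⁻¹ + B * m⁻¹ ^ 2) ^ 2 * (3 * (x ^ 2 + y ^ 2 + z ^ 2)) := by
        refine mul_le_mul_of_nonneg_left ?_ (sq_nonneg _)
        nlinarith [sq_nonneg (x - y), sq_nonneg (y - z), sq_nonneg (x - z)]
    _ = _ := by ring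

/-- Green's formula between `x` and a point `y` at distance `h`, paired with a cutoff that has
two-jet `e_j` at `x` and vanishes at `y`, expresses `[u(x), e_j]` as an integral in which only `u`
and `α u''' + β u'` occur. No interpolation inequality for the intermediate derivatives is needed.
-/
theorem IsJetOn.exists_pointwise_bound {h m B : ℝ} (hh : 0 < h) (hm : 0 < m) :
    ∃ C : ℝ, 0 ≤ C ∧ ∀ (I : Set ℝ), I.OrdConnected → ∀ α β : ℝ, m ≤ α → α ≤ B → |β| ≤ B →
      ∀ u, IsJetOn I u → ∀ x ∈ I, (x + h ∈ I ∨ x - h ∈ I) → ∀ k : Fin 3,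
        ‖u k.castSucc x‖ₑ ^ 2 ≤ ENNReal.ofReal C *
          ∫⁻ t in I ∩ Icc (x - h) (x + h),
            (‖u 0 t‖ₑ ^ 2 + ‖(α : ℂ) * u 3 t + β * u 1 t‖ₑ ^ 2) := by
  obtain ⟨η, hsm, hz, hjet, M, hM0, hM⟩ := exists_cutoff hh
  -- `D` bounds the squared Green integrand, `M` being the bound on the cutoffs. In the final
  -- constant, `h` comes from Cauchy–Schwarz on an interval of length `h`, the explicit `3` from
  -- summing over `j`, and `K` from recovering the jet from its three pairings.
  set D : ℝ := 2 * (M + 2 * |B| * M) ^ 2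
  have hD : 0 ≤ D := by positivity
  set K : ℝ := 3 * (m⁻¹ + B * m⁻¹ ^ 2) ^ 2
  have hK : 0 ≤ K := by positivity
  refine ⟨K * (3 * (h * D)), by positivity, fun I hI α β hα hαB hβ u hu x hx hxh k => ?_⟩
  set R := ∫⁻ t in I ∩ Icc (x - h) (x + h), (‖u 0 t‖ₑ ^ 2 + ‖(α : ℂ) * u 3 t + β * u 1 t‖ₑ ^ 2)
  obtain ⟨y, hy, hyx⟩ : ∃ y ∈ I, |y - x| = h := by
    rcases hxh with h' | h'
    · exact ⟨_, h', by simp [abs_of_pos hh]⟩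
    · exact ⟨_, h', by simp [abs_of_pos hh]⟩
  have hQ : ∀ j, ‖greenForm α β (fun k => u k.castSucc x) (Pi.single j 1)‖ₑ ^ 2 ≤
      ENNReal.ofReal (h * D) * R := fun j => by
    have hsm' : ContDiff ℝ ∞ (fun t => η j (t - x)) := (hsm j).comp (contDiff_id.sub contDiff_const)
    have hd : ∀ k : ℕ, iteratedDeriv k (fun t => η j (t - x)) = fun t =>
      iteratedDeriv k (η j) (t - x) := fun k => iteratedDeriv_comp_sub_const k (η j) x
    have hg := hu.green hI (IsJetOn.of_contDiff hsm') α β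
    have hgi := (hg x hx y hy).1
    have hg' := (hg x hx y hy).2
    simp only [hd] at hg' hgi
    have hv0 : (fun k : Fin 3 => iteratedDeriv (k.castSucc : Fin 4) (η j) (y - x)) = 0 :=
      funext fun k => hz j _ _ hyx.ge
    have hv1 : (fun k : Fin 3 => iteratedDeriv (k.castSucc : Fin 4) (η j) (x - x)) =
        Pi.single j 1 := funext fun k => by
      rw [sub_self, Fin.val_castSucc, hjet j k, Pi.single_apply]
      simp [eq_comm]
    rw [hv0, hv1] at hg'
    have hg0 : greenForm α β (fun k => u k.castSucc y) 0 = 0 := by simp [greenForm]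
    rw [hg0, zero_sub] at hg'
    set g : ℝ → ℂ := fun t =>
      (α * u 3 t + β * u 1 t) * iteratedDeriv ((0 : Fin 4) : ℕ) (η j) (t - x) +
        u 0 t * (α * iteratedDeriv ((3 : Fin 4) : ℕ) (η j) (t - x) +
          β * iteratedDeriv ((1 : Fin 4) : ℕ) (η j) (t - x))
    have hgpt : ∀ t, ‖g t‖ₑ ^ 2 ≤ ENNReal.ofReal D *
        (‖u 0 t‖ₑ ^ 2 + ‖(α : ℂ) * u 3 t + β * u 1 t‖ₑ ^ 2) := fun t => by
      refine enorm_sq_le_of_norm_sq_le hD ?_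
      have hαa : ‖(α : ℂ)‖ ≤ |B| := by
        rw [Complex.norm_real, Real.norm_eq_abs, abs_of_pos (hm.trans_le hα)]
        exact hαB.trans (le_abs_self B)
      have hβa : ‖(β : ℂ)‖ ≤ |B| := by
        rw [Complex.norm_real, Real.norm_eq_abs]
        exact hβ.trans (le_abs_self B)
      have h1 : ‖g t‖ ≤ ‖(α : ℂ) * u 3 t + β * u 1 t‖ * M + ‖u 0 t‖ * (|B| * M + |B| * M) := by
        refine (norm_add_le _ _).trans (add_le_add ?_ ?_)
        · rw [norm_mul]
          exact mul_le_mul_of_nonneg_left (hM j 0 _) (norm_nonneg _)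
        · rw [norm_mul]
          refine mul_le_mul_of_nonneg_left ((norm_add_le _ _).trans (add_le_add ?_ ?_))
            (norm_nonneg _)
          · rw [norm_mul]
            exact mul_le_mul hαa (hM j 3 _) (norm_nonneg _) (abs_nonneg _)
          · rw [norm_mul]
            exact mul_le_mul hβa (hM j 1 _) (norm_nonneg _) (abs_nonneg _)
      set a := ‖u 0 t‖
      set b := ‖(α : ℂ) * u 3 t + β * u 1 t‖
      have ha : 0 ≤ a := norm_nonneg _
      have hb : 0 ≤ b := norm_nonneg _
      have h2 : ‖g t‖ ≤ (M + 2 * |B| * M) * (a + b) := by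
        have q1 : 0 ≤ M * a := by positivity
        have q2 : 0 ≤ |B| * M * b := by positivity
        linarith
      calc ‖g t‖ ^ 2 ≤ ((M + 2 * |B| * M) * (a + b)) ^ 2 :=
            pow_le_pow_left₀ (norm_nonneg _) h2 2
        _ = (M + 2 * |B| * M) ^ 2 * (a + b) ^ 2 := by ring
        _ ≤ (M + 2 * |B| * M) ^ 2 * (2 * (a ^ 2 + b ^ 2)) :=
            mul_le_mul_of_nonneg_left add_sq_le (sq_nonneg _)
        _ = _ := by ring
    have hmeas : AEMeasurable (fun t => ‖g t‖ₑ) (volume.restrict (uIoc x y)) :=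
      (intervalIntegrable_iff.1 hgi).aestronglyMeasurable.enorm
    have hsub : uIoc x y ⊆ I ∩ Icc (x - h) (x + h) := by
      refine uIoc_subset_uIcc.trans (subset_inter (hI.uIcc_subset hx hy) fun t ht => ?_)
      have h1 := abs_sub_left_of_mem_uIcc ht
      rw [hyx] at h1
      have h2 := abs_le.1 h1
      exact ⟨by linarith [h2.1], by linarith [h2.2]⟩
    have hvol : volume.restrict (uIoc x y) univ = ENNReal.ofReal h := by
      rw [Measure.restrict_apply_univ, uIoc, Real.volume_Ioc, max_sub_min_eq_abs, hyx]
    rw [← enorm_neg, ← hg']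
    calc ‖∫ t in x..y, g t‖ₑ ^ 2 = ‖∫ t in uIoc x y, g t‖ₑ ^ 2 := by
          rw [← ofReal_norm, intervalIntegral.norm_integral_eq_norm_integral_uIoc,
            ofReal_norm]
      _ ≤ (∫⁻ t in uIoc x y, ‖g t‖ₑ) ^ 2 :=
          pow_le_pow_left' (enorm_integral_le_lintegral_enorm _) 2
      _ ≤ ENNReal.ofReal h * ∫⁻ t in uIoc x y, ‖g t‖ₑ ^ 2 := by
          rw [← hvol]
          exact lintegral_sq_le hmeas
      _ ≤ ENNReal.ofReal h * ∫⁻ t in uIoc x y, ENNReal.ofReal D *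
        (‖u 0 t‖ₑ ^ 2 + ‖(α : ℂ) * u 3 t + β * u 1 t‖ₑ ^ 2) := by
          gcongr with t
          exact hgpt t
      _ = ENNReal.ofReal (h * D) * ∫⁻ t in uIoc x y,
        (‖u 0 t‖ₑ ^ 2 + ‖(α : ℂ) * u 3 t + β * u 1 t‖ₑ ^ 2) := by
          rw [lintegral_const_mul' _ _ ENNReal.ofReal_ne_top, ENNReal.ofReal_mul hh.le, mul_assoc]
      _ ≤ _ := by
          gcongr
          exact lintegral_mono_set hsub
  have hfin := ENNReal.ofReal_le_ofReal
    (norm_sq_le_of_greenForm hm hα hβ (fun k => u k.castSucc x) k)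
  rw [ENNReal.ofReal_mul hK, ENNReal.ofReal_sum_of_nonneg (fun _ _ => by positivity)] at hfin
  simp only [ENNReal.ofReal_pow (norm_nonneg _), ofReal_norm] at hfin
  refine hfin.trans ?_
  rw [ENNReal.ofReal_mul hK, mul_assoc]
  gcongr
  refine (Finset.sum_le_sum fun j _ => hQ j).trans ?_
  rw [Finset.sum_const, Finset.card_univ, Fintype.card_fin, nsmul_eq_mul,
    ENNReal.ofReal_mul (by norm_num : (0 : ℝ) ≤ 3), mul_assoc]
  simp

/-- Tonelli's theorem: after exchanging the integrals, each `t` is counted by the `x` within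
distance `h`, a set of length at most `2h`. -/
theorem lintegral_le_of_window {I : Set ℝ} (hIm : MeasurableSet I) {s g : ℝ → ℝ≥0∞}
    {C : ℝ≥0∞} (hC : C ≠ ⊤) {h : ℝ} (hs : AEMeasurable s (volume.restrict I))
    (hg : ∀ x ∈ I, g x ≤ C * ∫⁻ t in I ∩ Icc (x - h) (x + h), s t) :
    ∫⁻ x in I, g x ≤ C * ENNReal.ofReal (2 * h) * ∫⁻ t in I, s t := by
  let S : Set (ℝ × ℝ) := {p | |p.1 - p.2| ≤ h}
  have hS : MeasurableSet S :=
    (isClosed_le (by fun_prop) continuous_const).measurableSet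
  let F : ℝ → ℝ → ℝ≥0∞ := fun x t => S.indicator (fun p => s p.2) (x, t)
  have hF : AEMeasurable (Function.uncurry F) ((volume.restrict I).prod (volume.restrict I)) :=
    (hs.comp_quasiMeasurePreserving Measure.quasiMeasurePreserving_snd).indicator hS
  have hin : ∀ x, ∫⁻ t in I ∩ Icc (x - h) (x + h), s t = ∫⁻ t in I, F x t := fun x => by
    rw [inter_comm, ← Measure.restrict_restrict measurableSet_Icc,
      ← lintegral_indicator measurableSet_Icc]
    refine lintegral_congr fun t => ?_
    have : t ∈ Icc (x - h) (x + h) ↔ (x, t) ∈ S := by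
      change _ ↔ |x - t| ≤ h
      rw [abs_le, mem_Icc]
      constructor <;> rintro ⟨h1, h2⟩ <;> constructor <;> linarith
    by_cases ht : t ∈ Icc (x - h) (x + h)
    · rw [indicator_of_mem ht]
      exact (indicator_of_mem (this.1 ht) (fun p : ℝ × ℝ => s p.2)).symm
    · rw [indicator_of_notMem ht]
      exact (indicator_of_notMem (fun h' => ht (this.2 h')) (fun p : ℝ × ℝ => s p.2)).symm
  calc ∫⁻ x in I, g x ≤ ∫⁻ x in I, C * ∫⁻ t in I, F x t :=
        setLIntegral_mono' hIm fun x hx => by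
          rw [← hin x]
          exact hg x hx
    _ = C * ∫⁻ x in I, ∫⁻ t in I, F x t := lintegral_const_mul' _ _ hC
    _ = C * ∫⁻ t in I, ∫⁻ x in I, F x t := by rw [lintegral_lintegral_swap hF]
    _ ≤ C * ∫⁻ t in I, ENNReal.ofReal (2 * h) * s t := by
        gcongr with t
        have : ∀ x, F x t = (Icc (t - h) (t + h)).indicator (fun _ => s t) x := fun x => by
          have h1 : x ∈ Icc (t - h) (t + h) ↔ (x, t) ∈ S := by
            change _ ↔ |x - t| ≤ h
            rw [abs_le, mem_Icc]
            constructor <;> rintro ⟨h1, h2⟩ <;> constructor <;> linarith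
          by_cases hx : x ∈ Icc (t - h) (t + h)
          · rw [indicator_of_mem hx]
            exact indicator_of_mem (h1.1 hx) (fun p : ℝ × ℝ => s p.2)
          · rw [indicator_of_notMem hx]
            exact indicator_of_notMem (fun h' => hx (h1.2 h')) (fun p : ℝ × ℝ => s p.2)
        calc ∫⁻ x in I, F x t ≤ ∫⁻ x, F x t := lintegral_mono' Measure.restrict_le_self le_rfl
          _ = ENNReal.ofReal (2 * h) * s t := by
            simp only [this]
            rw [lintegral_indicator measurableSet_Icc, setLIntegral_const, Real.volume_Icc,
              mul_comm]
            congr 2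
            ring
    _ = C * ENNReal.ofReal (2 * h) * ∫⁻ t in I, s t := by
        rw [lintegral_const_mul' _ _ ENNReal.ofReal_ne_top, mul_assoc]

/-! ### Behaviour of primitives at finite and infinite ends -/

theorem IsPrimitiveOn.exists_tendsto_nhdsLT {I : Set ℝ} {u w : ℝ → ℂ} (h : IsPrimitiveOn I u w)
    (hw : MemLp w 2 (volume.restrict I)) {x₀ b : ℝ} (hb : x₀ < b) (hI : Ico x₀ b ⊆ I) :
    ∃ z, Tendsto u (𝓝[<] b) (𝓝 z) := by
  have h1 : IntegrableOn w (Ico x₀ b) :=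
    (hw.mono_measure (Measure.restrict_mono hI le_rfl)).integrable (by norm_num)
  have h2 : IntegrableOn w (uIcc x₀ b) := by
    rw [uIcc_of_le hb.le, integrableOn_Icc_iff_integrableOn_Ico]
    exact h1
  have h3 := intervalIntegral.continuousOn_primitive_interval h2 b (by simp)
  rw [uIcc_of_le hb.le] at h3
  have h4 : Tendsto (fun x => (∫ t in x₀..x, w t) + u x₀) (𝓝[<] b)
      (𝓝 ((∫ t in x₀..b, w t) + u x₀)) := by
    refine Tendsto.add_const _ ((h3.tendsto).mono_left ?_)
    rw [← nhdsWithin_Ico_eq_nhdsLT hb]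
    exact nhdsWithin_mono _ Ico_subset_Icc_self
  refine ⟨_, h4.congr' ?_⟩
  rw [← nhdsWithin_Ico_eq_nhdsLT hb]
  filter_upwards [self_mem_nhdsWithin] with x hx
  rw [(h x₀ (hI (left_mem_Ico.2 hb)) x (hI hx)).2]
  ring

theorem IsPrimitiveOn.exists_tendsto_nhdsGT {I : Set ℝ} {u w : ℝ → ℂ} (h : IsPrimitiveOn I u w)
    (hw : MemLp w 2 (volume.restrict I)) {x₀ a : ℝ} (ha : a < x₀) (hI : Ioc a x₀ ⊆ I) :
    ∃ z, Tendsto u (𝓝[>] a) (𝓝 z) := by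
  have h1 : IntegrableOn w (Ioc a x₀) :=
    (hw.mono_measure (Measure.restrict_mono hI le_rfl)).integrable (by norm_num)
  have h2 : IntegrableOn w (uIcc a x₀) := by
    rw [uIcc_of_le ha.le, integrableOn_Icc_iff_integrableOn_Ioc]
    exact h1
  have h3 := intervalIntegral.continuousOn_primitive_interval_left h2 a (by simp)
  rw [uIcc_of_le ha.le] at h3
  have h4 : Tendsto (fun x => u x₀ - ∫ t in x..x₀, w t) (𝓝[>] a)
      (𝓝 (u x₀ - ∫ t in a..x₀, w t)) := by
    refine Tendsto.const_sub _ ((h3.tendsto).mono_left ?_)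
    rw [← nhdsWithin_Ioc_eq_nhdsGT ha]
    exact nhdsWithin_mono _ Ioc_subset_Icc_self
  refine ⟨_, h4.congr' ?_⟩
  rw [← nhdsWithin_Ioc_eq_nhdsGT ha]
  filter_upwards [self_mem_nhdsWithin] with x hx
  rw [(h x (hI hx) x₀ (hI (right_mem_Ioc.2 ha))).2]
  ring

/-- Integrability of `w` yields a limit of `u`; integrability of `u` on a half-line of infinite
measure forces that limit to be zero. -/
theorem IsPrimitiveOn.tendsto_atTop_zero {I : Set ℝ} {u w : ℝ → ℂ} (h : IsPrimitiveOn I u w)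
    (hw : IntegrableOn w I) (hu : IntegrableOn u I) {x₀ : ℝ} (hI : Ici x₀ ⊆ I) :
    Tendsto u atTop (𝓝 0) := by
  have h1 := intervalIntegral_tendsto_integral_Ioi x₀ (hw.mono_set (Ioi_subset_Ici_self.trans hI))
    tendsto_id
  have h2 : Tendsto u atTop (𝓝 ((∫ t in Ioi x₀, w t) + u x₀)) := by
    refine (h1.add_const (u x₀)).congr' ?_
    filter_upwards [eventually_ge_atTop x₀] with x hx
    rw [id, (h x₀ (hI self_mem_Ici) x (hI hx)).2]
    ring
  have h3 : IntegrableAtFilter u atTop volume := ⟨Ici x₀, Ici_mem_atTop x₀, hu.mono_set hI⟩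
  rwa [h3.eq_zero_of_tendsto (fun s hs => by
    obtain ⟨c, hc⟩ := mem_atTop_sets.1 hs
    refine eq_top_mono (measure_mono (fun y hy => hc y hy : Ici c ⊆ s)) ?_
    exact Real.volume_Ici) h2] at h2

theorem IsPrimitiveOn.tendsto_atBot_zero {I : Set ℝ} {u w : ℝ → ℂ} (h : IsPrimitiveOn I u w)
    (hw : IntegrableOn w I) (hu : IntegrableOn u I) {x₀ : ℝ} (hI : Iic x₀ ⊆ I) :
    Tendsto u atBot (𝓝 0) := by
  have h1 := intervalIntegral_tendsto_integral_Iic x₀ (hw.mono_set hI) tendsto_id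
  have h2 : Tendsto u atBot (𝓝 (u x₀ - ∫ t in Iic x₀, w t)) := by
    refine (h1.const_sub (u x₀)).congr' ?_
    filter_upwards [eventually_le_atBot x₀] with x hx
    rw [id, (h x (hI hx) x₀ (hI self_mem_Iic)).2]
    ring
  have h3 : IntegrableAtFilter u atBot volume := ⟨Iic x₀, Iic_mem_atBot x₀, hu.mono_set hI⟩
  rwa [h3.eq_zero_of_tendsto (fun s hs => by
    obtain ⟨c, hc⟩ := mem_atBot_sets.1 hs
    refine eq_top_mono (measure_mono (fun y hy => hc y hy : Iic c ⊆ s)) ?_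
    exact Real.volume_Iic) h2] at h2

/-- The intervals `Ioc p.1 p.2` exhaust `I` along `la ×ˢ lb`. Abstract filters let one statement
cover all four combinations of finite and infinite ends. -/
theorem IsPrimitiveOn.integral_eq_sub_of_tendsto {I : Set ℝ} (hI : I.OrdConnected)
    (hne : I.Nonempty) (hIm : MeasurableSet I)
    {u w : ℝ → ℂ} (h : IsPrimitiveOn I u w) (hw : IntegrableOn w I) {la lb : Filter ℝ}
    [la.NeBot] [lb.NeBot] [la.IsCountablyGenerated] [lb.IsCountablyGenerated]
    (hla : I ∈ la) (hlb : I ∈ lb) (hla' : ∀ y ∈ I, ∀ᶠ x in la, x < y)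
    (hlb' : ∀ y ∈ I, ∀ᶠ x in lb, y < x) {za zb : ℂ} (hza : Tendsto u la (𝓝 za))
    (hzb : Tendsto u lb (𝓝 zb)) : ∫ x in I, w x = zb - za := by
  have hcov : AECover (volume.restrict I) (la ×ˢ lb) (fun p => Ioc p.1 p.2) := by
    refine ⟨?_, fun _ => measurableSet_Ioc⟩
    filter_upwards [ae_restrict_mem hIm] with x hx
    filter_upwards [(hla' x hx).prod_mk (hlb' x hx)] with p hp using ⟨hp.1, hp.2.le⟩
  have h1 := hcov.integral_tendsto_of_countably_generated hw
  have h2 : Tendsto (fun p : ℝ × ℝ => u p.2 - u p.1) (la ×ˢ lb) (𝓝 (zb - za)) :=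
    (hzb.comp tendsto_snd).sub (hza.comp tendsto_fst)
  refine tendsto_nhds_unique (h1.congr' ?_) h2
  obtain ⟨y, hy⟩ := hne
  filter_upwards [((eventually_mem_set.2 hla).and (hla' y hy)).prod_mk
    ((eventually_mem_set.2 hlb).and (hlb' y hy))] with p hp
  have hlt := (hp.1.2.trans hp.2.2).le
  rw [← (h p.1 hp.1.1 p.2 hp.2.1).2, intervalIntegral.integral_of_le hlt,
    Measure.restrict_restrict measurableSet_Ioc, inter_eq_left.2 (fun t ht =>
      hI.out hp.1.1 hp.2.1 (Ioc_subset_Icc_self ht))]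

/-! ### Square-integrable regularity with uniform constants -/

theorem memLp_two_of_lintegral_le {I : Set ℝ} {u : ℝ → ℂ}
    (hu : AEStronglyMeasurable u (volume.restrict I)) {C : ℝ≥0∞} (hC : C ≠ ⊤)
    (h : ∫⁻ x in I, ‖u x‖ₑ ^ 2 ≤ C) : MemLp u 2 (volume.restrict I) := by
  refine ⟨hu, ?_⟩
  rw [eLpNorm_lt_top_iff_lintegral_rpow_enorm_lt_top (by norm_num) (by norm_num)]
  simpa using h.trans_lt hC.lt_top

theorem MeasureTheory.MemLp.locallyIntegrableOn_of_restrict {I : Set ℝ} {u : ℝ → ℂ}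
    (hu : MemLp u 2 (volume.restrict I)) : LocallyIntegrableOn u I :=
  locallyIntegrableOn_of_locallyIntegrable_restrict (hu.locallyIntegrable (by norm_num))

theorem IsPrimitiveOn.aestronglyMeasurable {I : Set ℝ} (hI : I.OrdConnected) (hIo : IsOpen I)
    {u w : ℝ → ℂ} (h : IsPrimitiveOn I u w) : AEStronglyMeasurable u (volume.restrict I) :=
  (h.continuousOn hI hIo).aestronglyMeasurable hIo.measurableSet

/-- Square-integrable distributional solutions of `α w''' + β w' = f` with square-integrable right
hand side have three square-integrable derivatives, with a bound depending only on bounds for the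
coefficients and on the length of the interval. -/
theorem exists_regularity_bound {h m B : ℝ} (hh : 0 < h) (hm : 0 < m) :
    ∃ C : ℝ, 0 ≤ C ∧ ∀ (I : Set ℝ), I.OrdConnected → IsOpen I →
      (∀ x ∈ I, x + h ∈ I ∨ x - h ∈ I) → ∀ α β : ℝ, m ≤ α → α ≤ B → |β| ≤ B →
      ∀ w f : ℝ → ℂ, MemLp w 2 (volume.restrict I) → MemLp f 2 (volume.restrict I) →
      (∀ φ, IsTestOn I φ → ∫ x in I, (α * deriv (deriv (deriv φ)) x + β * deriv φ x) • w x =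
        -∫ x in I, φ x • f x) →
      ∃ u, IsJetOn I u ∧ w =ᵐ[volume.restrict I] u 0 ∧ (∀ x, α * u 3 x + β * u 1 x = f x) ∧
        ∀ k, AEStronglyMeasurable (u k) (volume.restrict I) ∧
          ∫⁻ x in I, ‖u k x‖ₑ ^ 2 ≤ ENNReal.ofReal C * ∫⁻ x in I, (‖w x‖ₑ ^ 2 + ‖f x‖ₑ ^ 2) := by
  obtain ⟨C, hC, hbound⟩ := IsJetOn.exists_pointwise_bound (B := B) hh hm
  -- `C₁` serves the orders `0, 1, 2`: it is the pointwise constant integrated over windows of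
  -- length `2h`. `D` serves the third order, which is read off from the equation itself.
  set C₁ : ℝ := C * (2 * h)
  have hC₁ : 0 ≤ C₁ := by positivity
  set D : ℝ := 2 * m⁻¹ ^ 2 * (1 + B ^ 2)
  have hD : 0 ≤ D := by positivity
  refine ⟨C₁ + D * (1 + C₁), by positivity, ?_⟩
  intro I hI hIo hIh α β hα hαB hβ w f hw hf hweak
  have hα0 : 0 < α := hm.trans_le hα
  have hαc : (α : ℂ) ≠ 0 := by exact_mod_cast hα0.ne'
  obtain ⟨g₀, g₁, g₂, hwg, h0, h1, h2⟩ := exists_isPrimitiveOn_of_weak_eq hI hIo 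
    hw.locallyIntegrableOn_of_restrict hf.locallyIntegrableOn_of_restrict hα0.ne' hweak
  -- The top entry is obtained by solving the equation for the third derivative, so that `α u₃ + β
  -- u₁ = f` holds at every point.
  set u : Fin 4 → ℝ → ℂ := ![g₀, g₁, g₂, fun x => (α : ℂ)⁻¹ * (f x - β * g₁ x)] with hu
  have hjet : IsJetOn I u := by
    intro k
    fin_cases k
    exacts [h0, h1, h2]
  have heq : ∀ x, α * u 3 x + β * u 1 x = f x := fun x => by
    change (α : ℂ) * ((α : ℂ)⁻¹ * (f x - β * g₁ x)) + β * g₁ x = f x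
    field_simp
    ring
  set S := ∫⁻ x in I, (‖w x‖ₑ ^ 2 + ‖f x‖ₑ ^ 2)
  have hmeas3 : ∀ k : Fin 3, AEStronglyMeasurable (u k.castSucc) (volume.restrict I) := fun k =>
    (hjet k).aestronglyMeasurable hI hIo
  have hS : ∫⁻ x in I, (‖u 0 x‖ₑ ^ 2 + ‖f x‖ₑ ^ 2) = S := by
    refine lintegral_congr_ae ?_
    filter_upwards [hwg] with x hx
    rw [hx]
    rfl
  have hb3 : ∀ k : Fin 3, ∫⁻ x in I, ‖u k.castSucc x‖ₑ ^ 2 ≤ ENNReal.ofReal C₁ * S := fun k => by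
    rw [← hS, ENNReal.ofReal_mul hC]
    refine lintegral_le_of_window hIo.measurableSet ENNReal.ofReal_ne_top ?_ fun x hx => ?_
    · exact ((hmeas3 0).enorm.pow_const 2).add (hf.1.enorm.pow_const 2)
    · have := hbound I hI α β hα hαB hβ u hjet x hx (hIh x hx) k
      simpa only [heq] using this
  refine ⟨u, hjet, hwg, heq, fun k => ?_⟩
  induction k using Fin.lastCases with
  | cast k =>
    refine ⟨hmeas3 k, (hb3 k).trans ?_⟩
    gcongr
    have : 0 ≤ D * (1 + C₁) := by positivity
    linarith
  | last =>
    have hm3 : AEStronglyMeasurable (u 3) (volume.restrict I) :=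
      (hf.1.sub ((hmeas3 1).const_mul (β : ℂ))).const_mul (α : ℂ)⁻¹
    refine ⟨hm3, ?_⟩
    have hpt : ∀ x, ‖u 3 x‖ₑ ^ 2 ≤ ENNReal.ofReal D * (‖f x‖ₑ ^ 2 + ‖u 1 x‖ₑ ^ 2) := fun x => by
      refine enorm_sq_le_of_norm_sq_le hD ?_
      have h3 : ‖u 3 x‖ ≤ m⁻¹ * (‖f x‖ + |B| * ‖u 1 x‖) := by
        change ‖(α : ℂ)⁻¹ * (f x - β * g₁ x)‖ ≤ _
        rw [norm_mul, norm_inv, Complex.norm_real, Real.norm_eq_abs, abs_of_pos hα0]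
        refine mul_le_mul (inv_anti₀ hm hα) ((norm_sub_le _ _).trans (add_le_add le_rfl ?_))
          (norm_nonneg _) (inv_nonneg.2 hm.le)
        rw [norm_mul, Complex.norm_real, Real.norm_eq_abs]
        exact mul_le_mul_of_nonneg_right (hβ.trans (le_abs_self B)) (norm_nonneg _)
      calc ‖u 3 x‖ ^ 2 ≤ (m⁻¹ * (‖f x‖ + |B| * ‖u 1 x‖)) ^ 2 :=
            pow_le_pow_left₀ (norm_nonneg _) h3 2
        _ = m⁻¹ ^ 2 * (‖f x‖ + |B| * ‖u 1 x‖) ^ 2 := by ring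
        _ ≤ m⁻¹ ^ 2 * (2 * ((1 + B ^ 2) * (‖f x‖ ^ 2 + ‖u 1 x‖ ^ 2))) := by
            refine mul_le_mul_of_nonneg_left (add_sq_le.trans ?_) (sq_nonneg _)
            rw [mul_pow, sq_abs]
            nlinarith [sq_nonneg (‖u 1 x‖), mul_nonneg (sq_nonneg B) (sq_nonneg ‖f x‖)]
        _ = _ := by ring
    have hfS : ∫⁻ x in I, ‖f x‖ₑ ^ 2 ≤ S := lintegral_mono fun x => le_add_self
    calc ∫⁻ x in I, ‖u 3 x‖ₑ ^ 2
        ≤ ∫⁻ x in I, ENNReal.ofReal D * (‖f x‖ₑ ^ 2 + ‖u 1 x‖ₑ ^ 2) := lintegral_mono hpt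
      _ = ENNReal.ofReal D * ((∫⁻ x in I, ‖f x‖ₑ ^ 2) + ∫⁻ x in I, ‖u 1 x‖ₑ ^ 2) := by
          rw [lintegral_const_mul' _ _ ENNReal.ofReal_ne_top,
            lintegral_add_left' (hf.1.enorm.pow_const 2)]
      _ ≤ ENNReal.ofReal D * (S + ENNReal.ofReal C₁ * S) := by
          gcongr
          exact hb3 1
      _ = ENNReal.ofReal (D * (1 + C₁)) * S := by
          rw [ENNReal.ofReal_mul hD, ENNReal.ofReal_add zero_le_one hC₁, ENNReal.ofReal_one]
          ring
      _ ≤ _ := by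
          gcongr
          linarith

/-! ### Integrability in Green's formula and norms in Hilbert sums -/

namespace IsJetOn

variable {I : Set ℝ} {u v : Fin 4 → ℝ → ℂ}

theorem integrableOn_greenForm (hu : ∀ k, MemLp (u k) 2 (volume.restrict I))
    (hv : ∀ k, MemLp (v k) 2 (volume.restrict I)) (α β : ℂ) :
    IntegrableOn (fun x => greenForm α β (fun k => u k.castSucc x) (fun k => v k.castSucc x)) I :=
  (((((hu 2).integrable_mul (hv 0)).sub ((hu 1).integrable_mul (hv 1))).add
    ((hu 0).integrable_mul (hv 2))).const_mul α).add (((hu 0).integrable_mul (hv 0)).const_mul β)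

theorem integrableOn_green (hu : ∀ k, MemLp (u k) 2 (volume.restrict I))
    (hv : ∀ k, MemLp (v k) 2 (volume.restrict I)) (α β : ℂ) :
    IntegrableOn
      (fun x => (α * u 3 x + β * u 1 x) * v 0 x + u 0 x * (α * v 3 x + β * v 1 x)) I :=
  ((((hu 3).const_mul α).add ((hu 1).const_mul β)).integrable_mul (hv 0)).add
    ((hu 0).integrable_mul (((hv 3).const_mul α).add ((hv 1).const_mul β)))

end IsJetOn

theorem ofReal_norm_toLp_sq {I : Set ℝ} {f : ℝ → ℂ} (hf : MemLp f 2 (volume.restrict I)) :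
    ENNReal.ofReal (‖hf.toLp f‖ ^ 2) = ∫⁻ x in I, ‖f x‖ₑ ^ 2 := by
  rw [ENNReal.ofReal_pow (norm_nonneg _), Lp.norm_toLp, ENNReal.ofReal_toReal hf.2.ne,
    eLpNorm_eq_lintegral_rpow_enorm_toReal (by norm_num) (by norm_num), ← ENNReal.rpow_natCast,
    ← ENNReal.rpow_mul]
  norm_num

theorem ofReal_norm_sq_eq_lintegral {I : Set ℝ} (f : Lp ℂ 2 (volume.restrict I)) :
    ENNReal.ofReal (‖f‖ ^ 2) = ∫⁻ x in I, ‖f x‖ₑ ^ 2 := by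
  rw [← ofReal_norm_toLp_sq (Lp.memLp f), Lp.toLp_coeFn]

theorem memℓp_two_of_norm_sq_le {ι : Type*} {F : ι → Type*} [∀ i, NormedAddCommGroup (F i)]
    {f : ∀ i, F i} {s : ι → ℝ} (hs : Summable s) (h : ∀ i, ‖f i‖ ^ 2 ≤ s i) : Memℓp f 2 := by
  refine memℓp_gen ?_
  simp only [ENNReal.toReal_ofNat, Real.rpow_ofNat]
  exact hs.of_nonneg_of_le (fun i => sq_nonneg _) h

theorem summable_norm_sq {ι : Type*} {F : ι → Type*} [∀ i, NormedAddCommGroup (F i)]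
    (f : lp F 2) : Summable fun i => ‖f i‖ ^ 2 := by
  simpa using (lp.hasSum_norm (p := 2) (by norm_num) f).summable

namespace AiryCoeffs

theorem exists_bounds {ι : Type*} (c : AiryCoeffs ι) :
    ∃ m B : ℝ, 0 < m ∧ ∀ i, m ≤ c.α i ∧ c.α i ≤ B ∧ |c.β i| ≤ B := by
  obtain ⟨m, C, hm, h⟩ := c.α_bounds
  obtain ⟨C', h'⟩ := c.β_bounds
  exact ⟨m, max C C', hm, fun i => ⟨(h i).1, (h i).2.trans (le_max_left _ _),
    (h' i).trans (le_max_right _ _)⟩⟩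

end AiryCoeffs

/-! ### Edges, their ends and a uniform step -/

namespace MetricGraph

variable {V E : Type*} (G : MetricGraph V E)

theorem ordConnected_edge (e : E) : (G.edge e).OrdConnected :=
  ⟨fun _ hx _ hy _ ht => ⟨hx.1.trans_le (EReal.coe_le_coe_iff.2 ht.1),
    (EReal.coe_le_coe_iff.2 ht.2).trans_lt hy.2⟩⟩

theorem nonempty_edge (e : E) : (G.edge e).Nonempty := by
  obtain ⟨x, h1, h2⟩ := EReal.lt_iff_exists_real_btwn.1 (G.a_lt_b e)
  exact ⟨x, h1, h2⟩

theorem coe_toReal_a (e : G.El) : ((G.a e).toReal : EReal) = G.a e :=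
  EReal.coe_toReal (ne_top_of_lt (G.a_lt_b e)) e.2.ne'

theorem coe_toReal_b (e : G.Er) : ((G.b e).toReal : EReal) = G.b e :=
  EReal.coe_toReal e.2.ne (ne_bot_of_gt (G.a_lt_b e))

open Classical in
/-- The filter of one-sided neighbourhoods of the left end of the edge `e`. -/
noncomputable def leftEnd (e : E) : Filter ℝ := if ⊥ < G.a e then 𝓝[>] (G.a e).toReal else atBot

open Classical in
/-- The filter of one-sided neighbourhoods of the right end of the edge `e`. -/
noncomputable def rightEnd (e : E) : Filter ℝ := if G.b e < ⊤ then 𝓝[<] (G.b e).toReal else atTop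

theorem leftEnd_eq (e : G.El) : G.leftEnd e = 𝓝[>] (G.a e).toReal := if_pos e.2

theorem rightEnd_eq (e : G.Er) : G.rightEnd e = 𝓝[<] (G.b e).toReal := if_pos e.2

instance (e : E) : (G.leftEnd e).NeBot := by unfold leftEnd; split_ifs <;> infer_instance

instance (e : E) : (G.rightEnd e).NeBot := by unfold rightEnd; split_ifs <;> infer_instance

instance (e : E) : (G.leftEnd e).IsCountablyGenerated := by
  unfold leftEnd; split_ifs <;> infer_instance

instance (e : E) : (G.rightEnd e).IsCountablyGenerated := by
  unfold rightEnd; split_ifs <;> infer_instance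

theorem eventually_lt_leftEnd (e : E) {y : ℝ} (hy : y ∈ G.edge e) : ∀ᶠ x in G.leftEnd e, x < y := by
  by_cases h : ⊥ < G.a e
  · rw [G.leftEnd_eq ⟨e, h⟩]
    have : (G.a e).toReal < y := by
      rw [← EReal.coe_lt_coe_iff, G.coe_toReal_a ⟨e, h⟩]
      exact hy.1
    filter_upwards [mem_nhdsWithin_of_mem_nhds (Iio_mem_nhds this)] with x hx using hx
  · rw [leftEnd, if_neg h]
    exact eventually_lt_atBot y

theorem eventually_gt_rightEnd (e : E) {y : ℝ} (hy : y ∈ G.edge e) :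
    ∀ᶠ x in G.rightEnd e, y < x := by
  by_cases h : G.b e < ⊤
  · rw [G.rightEnd_eq ⟨e, h⟩]
    have : y < (G.b e).toReal := by
      rw [← EReal.coe_lt_coe_iff, G.coe_toReal_b ⟨e, h⟩]
      exact hy.2
    filter_upwards [mem_nhdsWithin_of_mem_nhds (Ioi_mem_nhds this)] with x hx using hx
  · rw [rightEnd, if_neg h]
    exact eventually_gt_atTop y

theorem Iic_subset_edge {e : E} (h : ¬ ⊥ < G.a e) {x : ℝ} (hx : x ∈ G.edge e) :
    Iic x ⊆ G.edge e := fun y hy => by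
  rw [not_bot_lt_iff] at h
  exact ⟨h ▸ EReal.bot_lt_coe y, (EReal.coe_le_coe_iff.2 hy).trans_lt hx.2⟩

theorem Ici_subset_edge {e : E} (h : ¬ G.b e < ⊤) {x : ℝ} (hx : x ∈ G.edge e) :
    Ici x ⊆ G.edge e := fun y hy => by
  rw [not_lt_top_iff] at h
  exact ⟨hx.1.trans_le (EReal.coe_le_coe_iff.2 hy), h ▸ EReal.coe_lt_top y⟩

theorem Ioc_subset_edge (e : G.El) {x : ℝ} (hx : x ∈ G.edge e) :
    Ioc (G.a e).toReal x ⊆ G.edge e := fun y hy => by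
  refine ⟨?_, (EReal.coe_le_coe_iff.2 hy.2).trans_lt hx.2⟩
  rw [← G.coe_toReal_a e]
  exact EReal.coe_lt_coe_iff.2 hy.1

theorem Ico_subset_edge (e : G.Er) {x : ℝ} (hx : x ∈ G.edge e) :
    Ico x (G.b e).toReal ⊆ G.edge e := fun y hy => by
  refine ⟨hx.1.trans_le (EReal.coe_le_coe_iff.2 hy.1), ?_⟩
  rw [← G.coe_toReal_b e]
  exact EReal.coe_lt_coe_iff.2 hy.2

theorem toReal_a_lt (e : G.El) {x : ℝ} (hx : x ∈ G.edge e) : (G.a e).toReal < x := by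
  rw [← EReal.coe_lt_coe_iff, G.coe_toReal_a e]
  exact hx.1

theorem lt_toReal_b (e : G.Er) {x : ℝ} (hx : x ∈ G.edge e) : x < (G.b e).toReal := by
  rw [← EReal.coe_lt_coe_iff, G.coe_toReal_b e]
  exact hx.2

theorem edge_mem_leftEnd (e : E) : G.edge e ∈ G.leftEnd e := by
  by_cases h : ⊥ < G.a e
  · rw [G.leftEnd_eq ⟨e, h⟩]
    exact edge_mem_nhdsGT ⟨e, h⟩
  · rw [leftEnd, if_neg h]
    obtain ⟨x, hx⟩ := G.nonempty_edge e
    exact mem_of_superset (Iic_mem_atBot x) (G.Iic_subset_edge h hx)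

theorem edge_mem_rightEnd (e : E) : G.edge e ∈ G.rightEnd e := by
  by_cases h : G.b e < ⊤
  · rw [G.rightEnd_eq ⟨e, h⟩]
    exact edge_mem_nhdsLT ⟨e, h⟩
  · rw [rightEnd, if_neg h]
    obtain ⟨x, hx⟩ := G.nonempty_edge e
    exact mem_of_superset (Ici_mem_atTop x) (G.Ici_subset_edge h hx)

/-- If the edge lengths are bounded below, a uniform step fits into all edges. -/
theorem exists_step (hlen : 0 < ⨅ e, (G.b e - G.a e)) : ∃ h : ℝ, 0 < h ∧
    (∀ e, ∀ x ∈ G.edge e, x + h ∈ G.edge e ∨ x - h ∈ G.edge e) ∧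
    ∀ e, ⊥ < G.a e → G.b e < ⊤ → h ≤ (G.b e).toReal - (G.a e).toReal := by
  obtain ⟨δ, hδ0, hδ⟩ := EReal.lt_iff_exists_real_btwn.1 hlen
  have hδ0' : 0 < δ := by exact_mod_cast hδ0
  have hδe : ∀ e, (δ : EReal) < G.b e - G.a e := fun e => hδ.trans_le (iInf_le _ e)
  -- Half the length bound: if both `x + δ / 2` and `x - δ / 2` left the edge, its length would be
  -- at most `δ`.
  refine ⟨δ / 2, by positivity, fun e x hx => ?_, fun e ha hb => ?_⟩
  · by_contra hcon
    rw [not_or] at hcon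
    have h1 : G.b e ≤ ((x + δ / 2 : ℝ) : EReal) := by
      by_contra h'
      refine hcon.1 ⟨hx.1.trans ?_, not_le.1 h'⟩
      exact EReal.coe_lt_coe_iff.2 (by linarith)
    have h2 : ((x - δ / 2 : ℝ) : EReal) ≤ G.a e := by
      by_contra h'
      refine hcon.2 ⟨not_le.1 h', lt_trans ?_ hx.2⟩
      exact EReal.coe_lt_coe_iff.2 (by linarith)
    have h3 := (hδe e).trans_le (EReal.sub_le_sub h1 h2)
    rw [← EReal.coe_sub, EReal.coe_lt_coe_iff] at h3
    linarith
  · have h3 := hδe e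
    rw [← G.coe_toReal_a ⟨e, ha⟩, ← G.coe_toReal_b ⟨e, hb⟩, ← EReal.coe_sub,
      EReal.coe_lt_coe_iff] at h3
    linarith

/-! ### Continuous representatives of Sobolev functions on the graph -/

variable {G}

theorem isWeakDeriv_D (u : G.W3) (k : Fin 3) : IsWeakDeriv (G.D k.castSucc u) (G.D k.succ u) := by
  have h := G.jet.mem_graph u
  rw [jet_graph] at h
  exact h.2 k

@[simp]
theorem D_zero (u : G.W3) : G.D 0 u = (u : G.HΓ) := by
  have h := G.jet.mem_graph u
  rw [jet_graph] at h
  exact h.1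

theorem exists_W3_of_isWeakDeriv (w : Fin 4 → G.HΓ)
    (hw : ∀ k : Fin 3, IsWeakDeriv (w k.castSucc) (w k.succ)) :
    ∃ u : G.W3, (u : G.HΓ) = w 0 ∧ ∀ k, G.D k u = w k := by
  have h : (w 0, w) ∈ G.jet.graph := by
    rw [jet_graph]
    exact ⟨rfl, hw⟩
  obtain ⟨u, hu1, hu2⟩ := (LinearPMap.mem_graph_iff _).1 h
  exact ⟨u, hu1, fun k => congrFun hu2 k⟩

/-- `U` consists of primitives representing the derivatives of `u` on the edge `e`. -/
structure IsRep (u : G.W3) (e : E) (U : Fin 4 → ℝ → ℂ) : Prop where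
  isJetOn : IsJetOn (G.edge e) U
  ae_eq : ∀ k, (G.D k u e : ℝ → ℂ) =ᵐ[volume.restrict (G.edge e)] U k

/-- The orders `0, 1, 2` are represented by primitives of the next weak derivative, whose integrand
may then be changed on a null set to its own representative; the third derivative keeps its `L₂`
representative. -/
theorem exists_isRep (u : G.W3) (e : E) : ∃ U, IsRep u e U := by
  have hloc : ∀ k, LocallyIntegrableOn (G.D k u e : ℝ → ℂ) (G.edge e) := fun k =>
    (Lp.memLp (G.D k u e)).locallyIntegrableOn_of_restrict
  have h : ∀ k : Fin 3, ∃ g, IsPrimitiveOn (G.edge e) g (G.D k.succ u e) ∧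
      (G.D k.castSucc u e : ℝ → ℂ) =ᵐ[volume.restrict (G.edge e)] g := fun k =>
    (isWeakDeriv_D u k e).exists_isPrimitiveOn (G.ordConnected_edge e) (G.isOpen_edge e)
      (hloc _) (hloc _)
  choose g hg hg' using h
  have hae : ∀ k : Fin 4, (G.D k u e : ℝ → ℂ) =ᵐ[volume.restrict (G.edge e)]
      (Fin.snoc (α := fun _ => ℝ → ℂ) g (G.D 3 u e : ℝ → ℂ) : Fin 4 → ℝ → ℂ) k := fun k => by
    induction k using Fin.lastCases with
    | cast k => rw [Fin.snoc_castSucc]; exact hg' k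
    | last => rw [Fin.snoc_last]; rfl
  refine ⟨_, fun k => ?_, hae⟩
  have h1 := (hg k).congr_right (G.ordConnected_edge e) (hae k.succ)
  rwa [Fin.snoc_castSucc]

namespace IsRep

variable {u v : G.W3} {e : E} {U W : Fin 4 → ℝ → ℂ}

theorem memLp (h : IsRep u e U) (k : Fin 4) : MemLp (U k) 2 (volume.restrict (G.edge e)) :=
  (Lp.memLp (G.D k u e)).ae_eq (h.ae_eq k)

theorem continuousOn (h : IsRep u e U) (k : Fin 3) : ContinuousOn (U k.castSucc) (G.edge e) :=
  (h.isJetOn k).continuousOn (G.ordConnected_edge e) (G.isOpen_edge e)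

theorem hasBoundaryValue_iff (h : IsRep u e U) (k : Fin 3) {l : Filter ℝ} (hl : G.edge e ∈ l)
    {z : ℂ} : HasBoundaryValue (G.edge e) l (G.D k.castSucc u e) z ↔
      Tendsto (U k.castSucc) l (𝓝 z) := by
  refine ⟨fun ⟨g, hg1, hg2, hg3⟩ => ?_, fun ht => ⟨_, h.continuousOn k, h.ae_eq _, ht⟩⟩
  have heq : EqOn g (U k.castSucc) (G.edge e) :=
    Measure.eqOn_open_of_ae_eq (hg2.symm.trans (h.ae_eq _)) (G.isOpen_edge e) hg1
      (h.continuousOn k)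
  exact hg3.congr' (by filter_upwards [hl] with x hx using heq hx)

theorem exists_tendsto_left (h : IsRep u e U) (he : ⊥ < G.a e) (k : Fin 3) :
    ∃ z, Tendsto (U k.castSucc) (𝓝[>] (G.a e).toReal) (𝓝 z) := by
  obtain ⟨x, hx⟩ := G.nonempty_edge e
  exact (h.isJetOn k).exists_tendsto_nhdsGT (h.memLp _) (G.toReal_a_lt ⟨e, he⟩ hx)
    (G.Ioc_subset_edge ⟨e, he⟩ hx)

theorem exists_tendsto_right (h : IsRep u e U) (he : G.b e < ⊤) (k : Fin 3) :
    ∃ z, Tendsto (U k.castSucc) (𝓝[<] (G.b e).toReal) (𝓝 z) := by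
  obtain ⟨x, hx⟩ := G.nonempty_edge e
  exact (h.isJetOn k).exists_tendsto_nhdsLT (h.memLp _) (G.lt_toReal_b ⟨e, he⟩ hx)
    (G.Ico_subset_edge ⟨e, he⟩ hx)

end IsRep

end MetricGraph

/-! ### Existence of the traces -/

namespace MetricGraph

variable {V E : Type*} {G : MetricGraph V E}

/-- The pointwise estimate with `α = 1`, `β = 0`; one constant serves all edges because one step
length does. -/
theorem exists_sup_bound (hlen : 0 < ⨅ e, (G.b e - G.a e)) : ∃ C : ℝ, ∀ (u : G.W3) (e : E) U,
    IsRep u e U → ∀ x ∈ G.edge e, ∀ k : Fin 3,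
      ‖U k.castSucc x‖ ^ 2 ≤ C * (‖G.D 0 u e‖ ^ 2 + ‖G.D 3 u e‖ ^ 2) := by
  obtain ⟨h, hh, hstep, -⟩ := G.exists_step hlen
  obtain ⟨C, hC, hb⟩ := IsJetOn.exists_pointwise_bound (B := 1) hh one_pos
  refine ⟨C, fun u e U hU x hx k => ?_⟩
  have h1 := hb (G.edge e) (G.ordConnected_edge e) 1 0 le_rfl le_rfl (by simp) U hU.isJetOn x hx
    (hstep e x hx) k
  simp only [Complex.ofReal_one, one_mul, Complex.ofReal_zero, zero_mul, add_zero] at h1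
  have h2 : ∫⁻ t in G.edge e ∩ Icc (x - h) (x + h), (‖U 0 t‖ₑ ^ 2 + ‖U 3 t‖ₑ ^ 2) ≤
      ENNReal.ofReal (‖G.D 0 u e‖ ^ 2 + ‖G.D 3 u e‖ ^ 2) := by
    refine (lintegral_mono_set inter_subset_left).trans (le_of_eq ?_)
    rw [ENNReal.ofReal_add (sq_nonneg _) (sq_nonneg _), ofReal_norm_sq_eq_lintegral,
      ofReal_norm_sq_eq_lintegral, ← lintegral_add_left'
        ((Lp.memLp (G.D 0 u e)).1.enorm.pow_const 2)]
    refine lintegral_congr_ae ?_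
    filter_upwards [hU.ae_eq 0, hU.ae_eq 3] with t h0 h3
    rw [h0, h3]
  have h3 := h1.trans (mul_le_mul' le_rfl h2)
  rw [← ENNReal.ofReal_mul hC, ← ofReal_norm, ← ENNReal.ofReal_pow (norm_nonneg _)] at h3
  exact (ENNReal.ofReal_le_ofReal_iff (by positivity)).1 h3

theorem exists_traceSpace {ι : Type*} {p : ι → Prop} (z : Fin 3 → {i // p i} → ℂ) {s : ι → ℝ}
    (hs : Summable s) (h : ∀ k i, ‖z k i‖ ^ 2 ≤ s i) :
    ∃ x : TraceSpace {i // p i}, ∀ k i, x k i = z k i :=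
  ⟨WithLp.toLp 2 fun k => ⟨z k, memℓp_two_of_norm_sq_le
    (hs.comp_injective Subtype.val_injective) (h k)⟩, fun _ _ => rfl⟩

theorem summable_jet_norm_sq (u : G.W3) (C : ℝ) :
    Summable fun e => C * (‖G.D 0 u e‖ ^ 2 + ‖G.D 3 u e‖ ^ 2) :=
  ((summable_norm_sq (G.D 0 u)).add (summable_norm_sq (G.D 3 u))).mul_left C

/-- Each limit exists edgewise; the uniform sup bound passes to the limit and is summable over the
edges, so the limits form an element of the trace space. -/
theorem exists_isTrl (hlen : 0 < ⨅ e, (G.b e - G.a e)) (u : G.W3) : ∃ x, IsTrl u x := by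
  obtain ⟨C, hC⟩ := exists_sup_bound hlen
  choose U hU using exists_isRep u
  choose z hz using fun (k : Fin 3) (e : G.El) => (hU e).exists_tendsto_left e.2 k
  obtain ⟨x, hx⟩ := exists_traceSpace z (summable_jet_norm_sq u C) fun k e =>
    le_of_tendsto ((hz k e).norm.pow 2) (by
      filter_upwards [edge_mem_nhdsGT e] with t ht using hC u e _ (hU e) t ht k)
  refine ⟨x, fun k e => ?_⟩
  rw [hx, (hU e).hasBoundaryValue_iff k (edge_mem_nhdsGT e)]
  exact hz k e

theorem exists_isTrr (hlen : 0 < ⨅ e, (G.b e - G.a e)) (u : G.W3) : ∃ x, IsTrr u x := by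
  obtain ⟨C, hC⟩ := exists_sup_bound hlen
  choose U hU using exists_isRep u
  choose z hz using fun (k : Fin 3) (e : G.Er) => (hU e).exists_tendsto_right e.2 k
  obtain ⟨x, hx⟩ := exists_traceSpace z (summable_jet_norm_sq u C) fun k e =>
    le_of_tendsto ((hz k e).norm.pow 2) (by
      filter_upwards [edge_mem_nhdsLT e] with t ht using hC u e _ (hU e) t ht k)
  refine ⟨x, fun k e => ?_⟩
  rw [hx, (hU e).hasBoundaryValue_iff k (edge_mem_nhdsLT e)]
  exact hz k e

/-! ### Green's formula on the graph -/

theorem tendsto_greenForm {l : Filter ℝ} {p q : Fin 3 → ℝ → ℂ} {p' q' : Fin 3 → ℂ} (α β : ℂ)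
    (hp : ∀ k, Tendsto (p k) l (𝓝 (p' k))) (hq : ∀ k, Tendsto (q k) l (𝓝 (q' k))) :
    Tendsto (fun x => greenForm α β (fun k => p k x) (fun k => q k x)) l
      (𝓝 (greenForm α β p' q')) :=
  (((((hp 2).mul (hq 0)).sub ((hp 1).mul (hq 1))).add ((hp 0).mul (hq 2))).const_mul α).add
    (((hp 0).mul (hq 0)).const_mul β)

open Classical in
/-- Green's formula on an edge. -/
theorem green_edge {u v : G.W3} {xl yl : TraceSpace G.El} {xr yr : TraceSpace G.Er}
    (hul : IsTrl u xl) (hvl : IsTrl v yl) (hur : IsTrr u xr) (hvr : IsTrr v yr) (α β : ℝ) (e : E) :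
    inner ℂ ((α : ℂ) • G.D 3 u e + (β : ℂ) • G.D 1 u e) (G.D 0 v e) +
      inner ℂ (G.D 0 u e) ((α : ℂ) • G.D 3 v e + (β : ℂ) • G.D 1 v e) =
    (if h : G.b e < ⊤ then
      greenForm α β (fun k => starRingEnd ℂ (xr k ⟨e, h⟩)) (fun k => yr k ⟨e, h⟩) else 0) -
    (if h : ⊥ < G.a e then
      greenForm α β (fun k => starRingEnd ℂ (xl k ⟨e, h⟩)) (fun k => yl k ⟨e, h⟩) else 0) := by
  obtain ⟨U, hU⟩ := exists_isRep u e
  obtain ⟨W, hW⟩ := exists_isRep v e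
  have hUc : ∀ k, MemLp (fun x => starRingEnd ℂ (U k x)) 2 (volume.restrict (G.edge e)) :=
    fun k => (Complex.conjCLE : ℂ →L[ℝ] ℂ).comp_memLp' (hU.memLp k)
  have hgi := IsJetOn.integrableOn_green hUc hW.memLp α β
  have hqi := IsJetOn.integrableOn_greenForm hUc hW.memLp α β
  have hp := hU.isJetOn.conj.green (G.ordConnected_edge e) hW.isJetOn α β
  have hlhs : inner ℂ ((α : ℂ) • G.D 3 u e + (β : ℂ) • G.D 1 u e) (G.D 0 v e) +
      inner ℂ (G.D 0 u e) ((α : ℂ) • G.D 3 v e + (β : ℂ) • G.D 1 v e) =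
      ∫ x in G.edge e, ((α * starRingEnd ℂ (U 3 x) + β * starRingEnd ℂ (U 1 x)) * W 0 x +
        starRingEnd ℂ (U 0 x) * (α * W 3 x + β * W 1 x)) := by
    rw [L2.inner_def, L2.inner_def, ← integral_add (L2.integrable_inner _ _)
      (L2.integrable_inner _ _)]
    refine integral_congr_ae ?_
    filter_upwards [hU.ae_eq 0, hU.ae_eq 1, hU.ae_eq 3, hW.ae_eq 0, hW.ae_eq 1, hW.ae_eq 3,
      Lp.coeFn_add ((α : ℂ) • G.D 3 u e) ((β : ℂ) • G.D 1 u e), Lp.coeFn_smul (α : ℂ) (G.D 3 u e),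
      Lp.coeFn_smul (β : ℂ) (G.D 1 u e),
      Lp.coeFn_add ((α : ℂ) • G.D 3 v e) ((β : ℂ) • G.D 1 v e), Lp.coeFn_smul (α : ℂ) (G.D 3 v e),
      Lp.coeFn_smul (β : ℂ) (G.D 1 v e)] with x a0 a1 a3 b0 b1 b3 c1 c2 c3 d1 d2 d3
    rw [c1, d1, Pi.add_apply, Pi.add_apply, c2, c3, d2, d3]
    simp only [Pi.smul_apply, smul_eq_mul, RCLike.inner_apply, map_add, map_mul,
      Complex.conj_ofReal, a0, a1, a3, b0, b1, b3]
    ring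
  rw [hlhs]
  refine hp.integral_eq_sub_of_tendsto (G.ordConnected_edge e) (G.nonempty_edge e)
    (G.isOpen_edge e).measurableSet hgi (G.edge_mem_leftEnd e) (G.edge_mem_rightEnd e)
    (fun y hy => G.eventually_lt_leftEnd e hy) (fun y hy => G.eventually_gt_rightEnd e hy) ?_ ?_
  · split_ifs with h
    · refine tendsto_greenForm (α : ℂ) β (fun k => ?_) (fun k => ?_)
      · refine (Complex.continuous_conj.tendsto _).comp ?_
        rw [G.leftEnd_eq ⟨e, h⟩]
        exact (hU.hasBoundaryValue_iff k (edge_mem_nhdsGT ⟨e, h⟩)).1 (hul k ⟨e, h⟩)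
      · rw [G.leftEnd_eq ⟨e, h⟩]
        exact (hW.hasBoundaryValue_iff k (edge_mem_nhdsGT ⟨e, h⟩)).1 (hvl k ⟨e, h⟩)
    -- At an infinite end the boundary form and its derivative are both integrable, so the boundary
    -- term vanishes.
    · rw [leftEnd, if_neg h]
      obtain ⟨x, hx⟩ := G.nonempty_edge e
      exact hp.tendsto_atBot_zero hgi hqi (G.Iic_subset_edge h hx)
  · split_ifs with h
    · refine tendsto_greenForm (α : ℂ) β (fun k => ?_) (fun k => ?_)
      · refine (Complex.continuous_conj.tendsto _).comp ?_
        rw [G.rightEnd_eq ⟨e, h⟩]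
        exact (hU.hasBoundaryValue_iff k (edge_mem_nhdsLT ⟨e, h⟩)).1 (hur k ⟨e, h⟩)
      · rw [G.rightEnd_eq ⟨e, h⟩]
        exact (hW.hasBoundaryValue_iff k (edge_mem_nhdsLT ⟨e, h⟩)).1 (hvr k ⟨e, h⟩)
    · rw [rightEnd, if_neg h]
      obtain ⟨x, hx⟩ := G.nonempty_edge e
      exact hp.tendsto_atTop_zero hgi hqi (G.Ici_subset_edge h hx)

/-- Links operator and boundary: the entries of `B_j` are those of `-greenForm`, with conjugation in
the first argument. -/
theorem hasSum_krein_form {ι : Type*} (c : AiryCoeffs ι) (x y : TraceSpace ι) :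
    HasSum (fun i => -greenForm (c.α i) (c.β i) (fun k => starRingEnd ℂ (x k i)) fun k => y k i)
      (c.krein.form x y) := by
  have h : c.krein.form x y = inner ℂ (-(c.mulβ (x 0)) - c.mulα (x 2)) (y 0) +
      inner ℂ (c.mulα (x 1)) (y 1) + inner ℂ (-(c.mulα (x 0))) (y 2) := by
    simp only [KreinSpace.form, PiLp.inner_apply, Fin.sum_univ_three]
    rfl
  rw [h]
  convert! ((lp.hasSum_inner (𝕜 := ℂ) (-(c.mulβ (x 0)) - c.mulα (x 2)) (y 0)).add
    (lp.hasSum_inner (𝕜 := ℂ) (c.mulα (x 1)) (y 1))).add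
      (lp.hasSum_inner (𝕜 := ℂ) (-(c.mulα (x 0))) (y 2)) using 2 with i
  simp only [greenForm, AiryCoeffs.mulα, AiryCoeffs.mulβ, lp.coeFn_sub, lp.coeFn_neg, Pi.sub_apply,
    Pi.neg_apply, mulOp_apply, RCLike.inner_apply, map_sub, map_neg, smul_eq_mul, map_mul,
    Complex.conj_ofReal]
  ring

/-- Extension by zero to all edges, so that left and right boundary sums can be subtracted termwise
over one index set. -/
theorem hasSum_krein_form_restrict {ι : Type*} (c : AiryCoeffs ι) (p : ι → Prop)
    [DecidablePred p] (x y : TraceSpace {i // p i}) :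
    HasSum (fun i => if h : p i then greenForm (c.α i) (c.β i)
      (fun k => starRingEnd ℂ (x k ⟨i, h⟩)) (fun k => y k ⟨i, h⟩) else 0)
      (-(c.restrict p).krein.form x y) := by
  rw [← Function.Injective.hasSum_iff (g := ((↑) : {i // p i} → ι)) Subtype.val_injective]
  · convert! (hasSum_krein_form (c.restrict p) x y).neg using 2 with i
    rw [neg_neg, Function.comp_apply, dif_pos i.2]
    rfl
  · intro i hi
    exact dif_neg fun h => hi ⟨⟨i, h⟩, rfl⟩

/-- Green's formula on the graph. -/
theorem inner_maxOp_add (c : AiryCoeffs E) {u v : G.W3} {xl yl : TraceSpace G.El}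
    {xr yr : TraceSpace G.Er} (hul : IsTrl u xl) (hvl : IsTrl v yl) (hur : IsTrr u xr)
    (hvr : IsTrr v yr) :
    inner ℂ (G.maxOp c u) (v : G.HΓ) + inner ℂ (u : G.HΓ) (G.maxOp c v) =
      (G.kreinL c).form xl yl - (G.kreinR c).form xr yr := by
  classical
  have h1 := (lp.hasSum_inner (𝕜 := ℂ) (G.maxOp c u) (v : G.HΓ)).add
    (lp.hasSum_inner (𝕜 := ℂ) (u : G.HΓ) (G.maxOp c v))
  have h2 := (hasSum_krein_form_restrict c (fun e => G.b e < ⊤) xr yr).sub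
    (hasSum_krein_form_restrict c (fun e => ⊥ < G.a e) xl yl)
  rw [neg_sub_neg] at h2
  refine h1.unique ?_
  convert! h2 using 2 with e
  rw [← D_zero, ← D_zero]
  exact green_edge hul hvl hur hvr (c.α e) (c.β e) e

end MetricGraph

/-! ### Construction of Sobolev functions and surjectivity of the traces -/

theorem iteratedDeriv_ofReal_comp {φ : ℝ → ℝ} (hφ : ContDiff ℝ ∞ φ) (k : ℕ) :
    iteratedDeriv k (fun x => (φ x : ℂ)) = fun x => ((iteratedDeriv k φ x : ℝ) : ℂ) := by
  induction k with
  | zero => simp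
  | succ k ih =>
    funext x
    have hd : ContDiff ℝ ∞ (iteratedDeriv k φ) := by
      rw [iteratedDeriv_eq_iterate]
      exact hφ.iterate_deriv k
    rw [iteratedDeriv_succ, ih, iteratedDeriv_succ]
    exact ((hd.differentiable (by simp)).differentiableAt (x := x)).hasDerivAt.ofReal_comp.deriv

theorem HasWeakDerivOn.congr {I : Set ℝ} {u w u' w' : ℝ → ℂ} (h : HasWeakDerivOn I u w)
    (hu : u =ᵐ[volume.restrict I] u') (hw : w =ᵐ[volume.restrict I] w') :
    HasWeakDerivOn I u' w' := fun φ hφ hc hs => by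
  have h1 : ∫ x in I, deriv φ x • u' x = ∫ x in I, deriv φ x • u x :=
    integral_congr_ae (hu.mono fun x hx => by simp only [hx])
  have h2 : ∫ x in I, φ x • w' x = ∫ x in I, φ x • w x :=
    integral_congr_ae (hw.mono fun x hx => by simp only [hx])
  rw [h1, h2, h φ hφ hc hs]

namespace MetricGraph

variable {V E : Type*} {G : MetricGraph V E}

theorem exists_W3_of_isJetOn (U : E → Fin 4 → ℝ → ℂ) (hU : ∀ e, IsJetOn (G.edge e) (U e))
    (hm : ∀ e k, AEStronglyMeasurable (U e k) (volume.restrict (G.edge e))) {s : E → ℝ}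
    (hs : Summable s)
    (hb : ∀ e k, ∫⁻ x in G.edge e, ‖U e k x‖ₑ ^ 2 ≤ ENNReal.ofReal (s e)) :
    ∃ u : G.W3, ∀ e k, (G.D k u e : ℝ → ℂ) =ᵐ[volume.restrict (G.edge e)] U e k := by
  have hL : ∀ e k, MemLp (U e k) 2 (volume.restrict (G.edge e)) := fun e k =>
    memLp_two_of_lintegral_le (hm e k) ENNReal.ofReal_ne_top (hb e k)
  have hmem : ∀ k, Memℓp (fun e => (hL e k).toLp (U e k)) 2 := fun k =>
    memℓp_two_of_norm_sq_le hs.abs fun e => by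
      rw [← ENNReal.ofReal_le_ofReal_iff (abs_nonneg _), ofReal_norm_toLp_sq]
      exact (hb e k).trans (ENNReal.ofReal_le_ofReal (le_abs_self _))
  let w : Fin 4 → G.HΓ := fun k => ⟨fun e => (hL e k).toLp (U e k), hmem k⟩
  have hw : ∀ e k, (w k e : ℝ → ℂ) =ᵐ[volume.restrict (G.edge e)] U e k := fun e k =>
    (hL e k).coeFn_toLp
  obtain ⟨u, -, hu⟩ := exists_W3_of_isWeakDeriv w fun k e =>
    ((hU e k).hasWeakDerivOn (G.ordConnected_edge e) (G.isOpen_edge e)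
      (hL e _).locallyIntegrableOn_of_restrict).congr (hw e _).symm (hw e _).symm
  exact ⟨u, fun e k => by rw [hu k]; exact hw e k⟩

theorem lintegral_shift_cutoff_le {h M : ℝ} {η : ℝ → ℂ} (hz : ∀ x, h ≤ |x| → η x = 0)
    (hM : ∀ x, ‖η x‖ ≤ M) (I : Set ℝ) (p : ℝ) :
    ∫⁻ x in I, ‖η (x - p)‖ₑ ^ 2 ≤ ENNReal.ofReal (M ^ 2 * (2 * h)) := by
  have hpt : ∀ x, ‖η (x - p)‖ₑ ^ 2 ≤
      (Icc (p - h) (p + h)).indicator (fun _ => ENNReal.ofReal (M ^ 2)) x := fun x => by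
    by_cases hx : x ∈ Icc (p - h) (p + h)
    · rw [indicator_of_mem hx, ← ofReal_norm, ← ENNReal.ofReal_pow (norm_nonneg _)]
      exact ENNReal.ofReal_le_ofReal (pow_le_pow_left₀ (norm_nonneg _) (hM _) 2)
    · have : h ≤ |x - p| := by
        by_contra hcon
        have := abs_lt.1 (not_le.1 hcon)
        exact hx ⟨by linarith [this.1], by linarith [this.2]⟩
      rw [hz _ this]
      simp
  calc ∫⁻ x in I, ‖η (x - p)‖ₑ ^ 2 ≤ ∫⁻ x, ‖η (x - p)‖ₑ ^ 2 :=
        lintegral_mono' Measure.restrict_le_self le_rfl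
    _ ≤ ∫⁻ x, (Icc (p - h) (p + h)).indicator (fun _ => ENNReal.ofReal (M ^ 2)) x :=
        lintegral_mono hpt
    _ = ENNReal.ofReal (M ^ 2 * (2 * h)) := by
        rw [lintegral_indicator measurableSet_Icc, setLIntegral_const, Real.volume_Icc,
          ← ENNReal.ofReal_mul (sq_nonneg M)]
        congr 2
        ring

/-- Families of cutoff functions, translated to given points, with square-summable coefficients
belong to the Hilbert sum of Sobolev spaces. -/
theorem exists_W3_of_cutoff {h : ℝ} {η : ℝ → ℂ} (hη : ContDiff ℝ ∞ η)
    (hz : ∀ (k : ℕ) x, h ≤ |x| → iteratedDeriv k η x = 0) {M : ℝ}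
    (hM : ∀ (k : Fin 4) x, ‖iteratedDeriv k η x‖ ≤ M) {ξ : E → ℂ}
    (hξ : Summable fun e => ‖ξ e‖ ^ 2) (p : E → ℝ) :
    ∃ u : G.W3, ∀ e k, (G.D k u e : ℝ → ℂ) =ᵐ[volume.restrict (G.edge e)]
      fun t => ξ e * iteratedDeriv k η (t - p e) := by
  have hsm : ∀ e, ContDiff ℝ ∞ (fun t => ξ e * η (t - p e)) := fun e =>
    contDiff_const.mul (hη.comp (contDiff_id.sub contDiff_const))
  have hd : ∀ e (k : ℕ), iteratedDeriv k (fun t => ξ e * η (t - p e)) =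
      fun t => ξ e * iteratedDeriv k η (t - p e) := fun e k => by
    funext t
    have h1 : ContDiffAt ℝ k (fun t => η (t - p e)) t :=
      ((hη.comp (contDiff_id.sub contDiff_const)).of_le (by exact_mod_cast le_top)).contDiffAt
    rw [iteratedDeriv_const_mul _ h1, iteratedDeriv_comp_sub_const]
  refine exists_W3_of_isJetOn (fun e k t => ξ e * iteratedDeriv k η (t - p e)) (fun e => ?_)
    (fun e k => ?_) (hξ.mul_right (M ^ 2 * (2 * h))) fun e k => ?_
  · have := IsJetOn.of_contDiff (I := G.edge e) (hsm e)
    simpa only [hd] using this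
  · exact (continuous_const.mul ((hη.iteratedDeriv_infty k).continuous.comp
      (continuous_id.sub continuous_const))).aestronglyMeasurable
  · simp only [enorm_mul, mul_pow]
    rw [lintegral_const_mul' _ _ (by finiteness), ENNReal.ofReal_mul (sq_nonneg _),
      ENNReal.ofReal_pow (norm_nonneg _), ofReal_norm]
    gcongr
    exact lintegral_shift_cutoff_le (hz k) (hM k) _ _

theorem hasBoundaryValue_of_continuous {e : E} {f g : ℝ → ℂ} {l : Filter ℝ} {p : ℝ}
    (hfg : f =ᵐ[volume.restrict (G.edge e)] g) (hg : Continuous g) (hl : l ≤ 𝓝 p) {z : ℂ}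
    (hz : g p = z) : HasBoundaryValue (G.edge e) l f z :=
  ⟨g, hg.continuousOn, hfg, hz ▸ (hg.tendsto p).mono_left hl⟩

theorem summable_extend {p : E → Prop} [DecidablePred p] (x : lp (fun _ : {e // p e} => ℂ) 2) :
    Summable fun e => ‖if h : p e then x ⟨e, h⟩ else 0‖ ^ 2 := by
  rw [← Function.Injective.summable_iff (g := ((↑) : {e // p e} → E)) Subtype.val_injective]
  · convert! summable_norm_sq x using 2 with e
    rw [Function.comp_apply, dif_pos e.2]
  · intro e he
    rw [dif_neg fun h => he ⟨⟨e, h⟩, rfl⟩]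
    simp

theorem isTrl_zero : IsTrl (0 : G.W3) 0 := fun k e => by
  rw [map_zero]
  exact HasBoundaryValue.zero _ _

theorem isTrr_zero : IsTrr (0 : G.W3) 0 := fun k e => by
  rw [map_zero]
  exact HasBoundaryValue.zero _ _

theorem IsTrl.add {u v : G.W3} {x y : TraceSpace G.El} (hx : IsTrl u x) (hy : IsTrl v y) :
    IsTrl (u + v) (x + y) := fun k e => by
  rw [map_add]
  exact HasBoundaryValue.add (hx k e) (hy k e)

theorem IsTrr.add {u v : G.W3} {x y : TraceSpace G.Er} (hx : IsTrr u x) (hy : IsTrr v y) :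
    IsTrr (u + v) (x + y) := fun k e => by
  rw [map_add]
  exact HasBoundaryValue.add (hx k e) (hy k e)

/-- The additive monoid of all pairs of left and right traces. -/
def traceRange (G : MetricGraph V E) : AddSubmonoid (TraceSpace G.El × TraceSpace G.Er) where
  carrier := {q | ∃ u : G.W3, IsTrl u q.1 ∧ IsTrr u q.2}
  zero_mem' := ⟨0, isTrl_zero, isTrr_zero⟩
  add_mem' := fun {_ _} ⟨u, hu, hu'⟩ ⟨v, hv, hv'⟩ => ⟨u + v, hu.add hv, hu'.add hv'⟩

theorem traceSpace_eq_sum {ι : Type*} (x : TraceSpace ι) :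
    x = ∑ j : Fin 3, WithLp.toLp 2 (Pi.single j (x j)) := by
  ext k : 1
  rw [WithLp.ofLp_sum, Finset.sum_apply]
  simp

/-- On each edge the `j`-th cutoff is translated to the left end and multiplied by the value of `x`.
Its support radius `h` does not exceed the length of a finite edge, so the right trace vanishes. On
edges with `a e = ⊥` the coefficient is zero, so the default value of `toReal` there does no harm.
-/
theorem toLp_single_mem_traceRange_left (hlen : 0 < ⨅ e, (G.b e - G.a e)) (j : Fin 3)
    (x : lp (fun _ : G.El => ℂ) 2) :
    ((WithLp.toLp 2 (Pi.single j x) : TraceSpace G.El), (0 : TraceSpace G.Er)) ∈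
      G.traceRange := by
  classical
  obtain ⟨h, hh, -, hdist⟩ := G.exists_step hlen
  obtain ⟨η, hsm, hz, hjet, M, -, hM⟩ := exists_cutoff hh
  obtain ⟨u, hu⟩ := exists_W3_of_cutoff (G := G) (hsm j) (hz j) (hM j) (summable_extend x)
    fun e => (G.a e).toReal
  have hc : ∀ e (k : ℕ), Continuous fun t => (if h : ⊥ < G.a e then x ⟨e, h⟩ else 0) *
      iteratedDeriv k (η j) (t - (G.a e).toReal) := fun e k =>
    continuous_const.mul (((hsm j).iteratedDeriv_infty k).continuous.comp
      (continuous_id.sub continuous_const))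
  refine ⟨u, fun k e => ?_, fun k e => ?_⟩
  · refine hasBoundaryValue_of_continuous (hu e _) (hc e _) nhdsWithin_le_nhds ?_
    rw [dif_pos e.2, sub_self, Fin.val_castSucc, hjet]
    by_cases hjk : j = k
    · subst hjk
      simp
    · simp [hjk]
  · refine hasBoundaryValue_of_continuous (hu e _) (hc e _) nhdsWithin_le_nhds ?_
    split_ifs with he
    · rw [hz j _ _ ((hdist e he e.2).trans (le_abs_self _)), mul_zero]
      simp
    · simp

theorem toLp_single_mem_traceRange_right (hlen : 0 < ⨅ e, (G.b e - G.a e)) (j : Fin 3)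
    (x : lp (fun _ : G.Er => ℂ) 2) :
    ((0 : TraceSpace G.El), (WithLp.toLp 2 (Pi.single j x) : TraceSpace G.Er)) ∈
      G.traceRange := by
  classical
  obtain ⟨h, hh, -, hdist⟩ := G.exists_step hlen
  obtain ⟨η, hsm, hz, hjet, M, -, hM⟩ := exists_cutoff hh
  obtain ⟨u, hu⟩ := exists_W3_of_cutoff (G := G) (hsm j) (hz j) (hM j) (summable_extend x)
    fun e => (G.b e).toReal
  have hc : ∀ e (k : ℕ), Continuous fun t => (if h : G.b e < ⊤ then x ⟨e, h⟩ else 0) *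
      iteratedDeriv k (η j) (t - (G.b e).toReal) := fun e k =>
    continuous_const.mul (((hsm j).iteratedDeriv_infty k).continuous.comp
      (continuous_id.sub continuous_const))
  refine ⟨u, fun k e => ?_, fun k e => ?_⟩
  · refine hasBoundaryValue_of_continuous (hu e _) (hc e _) nhdsWithin_le_nhds ?_
    split_ifs with he
    · rw [hz j _ _ (((hdist e e.2 he).trans (le_abs_self _)).trans_eq (abs_sub_comm _ _)),
        mul_zero]
      simp
    · simp
  · refine hasBoundaryValue_of_continuous (hu e _) (hc e _) nhdsWithin_le_nhds ?_
    rw [dif_pos e.2, sub_self, Fin.val_castSucc, hjet]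
    by_cases hjk : j = k
    · subst hjk
      simp
    · simp [hjk]

/-- The pair of trace maps is surjective. -/
theorem exists_W3_of_traces (hlen : 0 < ⨅ e, (G.b e - G.a e)) (x : TraceSpace G.El)
    (y : TraceSpace G.Er) : ∃ u : G.W3, IsTrl u x ∧ IsTrr u y := by
  -- Splits the pair of traces into six pieces, each with a single nonzero component at one end.
  have h : (x, y) = (∑ j : Fin 3, ((WithLp.toLp 2 (Pi.single j (x j)) : TraceSpace G.El),
      (0 : TraceSpace G.Er))) + ∑ j : Fin 3, ((0 : TraceSpace G.El),
        (WithLp.toLp 2 (Pi.single j (y j)) : TraceSpace G.Er)) := by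
    ext1
    · rw [Prod.fst_add, Prod.fst_sum, Prod.fst_sum, Finset.sum_const_zero, add_zero]
      exact traceSpace_eq_sum x
    · rw [Prod.snd_add, Prod.snd_sum, Prod.snd_sum, Finset.sum_const_zero, zero_add]
      exact traceSpace_eq_sum y
  have h2 : (x, y) ∈ G.traceRange := by
    rw [h]
    exact add_mem (sum_mem fun j _ => toLp_single_mem_traceRange_left hlen j _)
      (sum_mem fun j _ => toLp_single_mem_traceRange_right hlen j _)
  exact h2

/-- Test functions on a single edge, as elements of the Hilbert sum of Sobolev spaces. -/
theorem exists_W3_of_isTestOn {e₀ : E} {φ : ℝ → ℝ} (hφ : IsTestOn (G.edge e₀) φ) :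
    ∃ u : G.W3, IsTrl u 0 ∧ IsTrr u 0 ∧ (∀ k e, e ≠ e₀ → G.D k u e = 0) ∧
      ∀ k, (G.D k u e₀ : ℝ → ℂ) =ᵐ[volume.restrict (G.edge e₀)]
        fun x => ((iteratedDeriv k φ x : ℝ) : ℂ) := by
  classical
  let ψ : E → ℝ → ℂ := fun e x => if e = e₀ then (φ x : ℂ) else 0
  have hφc : ContDiff ℝ ∞ fun x => (φ x : ℂ) := Complex.ofRealCLM.contDiff.comp hφ.contDiff
  have hψ0 : ψ e₀ = fun x => (φ x : ℂ) := funext fun x => if_pos rfl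
  have hψ1 : ∀ e, e ≠ e₀ → ψ e = fun _ => 0 := fun e he => funext fun x => if_neg he
  have hψ : ∀ e, ContDiff ℝ ∞ (ψ e) := fun e => by
    by_cases he : e = e₀
    · rw [he, hψ0]; exact hφc
    · rw [hψ1 e he]; exact contDiff_const
  have htest : ∀ k : ℕ, IsTestOn (G.edge e₀) (iteratedDeriv k φ) := fun k => by
    induction k with
    | zero => simpa using hφ
    | succ k ih => rw [iteratedDeriv_succ]; exact ih.deriv
  have hd0 : ∀ k : ℕ, iteratedDeriv k (ψ e₀) = fun x => ((iteratedDeriv k φ x : ℝ) : ℂ) :=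
    fun k => by rw [hψ0, iteratedDeriv_ofReal_comp hφ.contDiff]
  have hd1 : ∀ (k : ℕ) e, e ≠ e₀ → iteratedDeriv k (ψ e) = fun _ => 0 := fun k e he => by
    rw [hψ1 e he]
    funext x
    simp
  -- End points do not belong to the open edge, so this gives the vanishing of both traces.
  have hout : ∀ (k : ℕ) e x, x ∉ G.edge e → iteratedDeriv k (ψ e) x = 0 := fun k e x hx => by
    by_cases he : e = e₀
    · subst he
      rw [hd0]
      beta_reduce
      rw [(htest k).eq_zero hx, Complex.ofReal_zero]
    · rw [hd1 k e he]
  have hL : ∀ k : Fin 4, MemLp (iteratedDeriv k (ψ e₀)) 2 (volume.restrict (G.edge e₀)) :=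
    fun k => by
    rw [hd0]
    refine (Continuous.memLp_of_hasCompactSupport ?_ ?_).restrict _
    · exact Complex.continuous_ofReal.comp (htest k).contDiff.continuous
    · exact (htest k).hasCompactSupport.comp_left Complex.ofReal_zero
  let S : ℝ := ∑ k : Fin 4, ‖(hL k).toLp _‖ ^ 2
  obtain ⟨u, hu⟩ := exists_W3_of_isJetOn (G := G) (fun e k => iteratedDeriv k (ψ e))
    (fun e => IsJetOn.of_contDiff (hψ e))
    (fun e k => ((hψ e).iteratedDeriv_infty k).continuous.aestronglyMeasurable)
    (s := fun e => if e = e₀ then S else 0) (hasSum_ite_eq e₀ S).summable (fun e k => by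
      by_cases he : e = e₀
      · subst he
        rw [if_pos rfl, ← ofReal_norm_toLp_sq (hL k)]
        refine ENNReal.ofReal_le_ofReal ?_
        exact Finset.single_le_sum (f := fun k => ‖(hL k).toLp _‖ ^ 2)
          (fun _ _ => sq_nonneg _) (Finset.mem_univ k)
      · simp [hd1 k e he])
  refine ⟨u, fun k e => ?_, fun k e => ?_, fun k e he => ?_, fun k => ?_⟩
  · refine hasBoundaryValue_of_continuous (hu e _) ((hψ e).iteratedDeriv_infty _).continuous
      nhdsWithin_le_nhds (hout _ _ _ fun hx => ?_)
    exact lt_irrefl _ (G.toReal_a_lt e hx)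
  · refine hasBoundaryValue_of_continuous (hu e _) ((hψ e).iteratedDeriv_infty _).continuous
      nhdsWithin_le_nhds (hout _ _ _ fun hx => ?_)
    exact lt_irrefl _ (G.lt_toReal_b e hx)
  · refine Lp.ext ((hu e k).trans ?_)
    rw [hd1 k e he]
    exact (Lp.coeFn_zero _ _ _).symm
  · rw [← hd0]
    exact hu e₀ k

end MetricGraph

/-! ### The adjoint of `A_L` -/

namespace MetricGraph

variable {V E : Type*} {G : MetricGraph V E}

theorem inner_eq_inner_single {w y : G.HΓ} {e₀ : E} (h : ∀ e, e ≠ e₀ → w e = 0) :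
    inner ℂ w y = inner ℂ (w e₀) (y e₀) :=
  (lp.hasSum_inner (𝕜 := ℂ) w y).unique (hasSum_single e₀ fun e he => by
    rw [h e he, inner_zero_left])

theorem inner_eq_integral_smul {I : Set ℝ} {f y : Lp ℂ 2 (volume.restrict I)} {φ : ℝ → ℝ}
    (h : (f : ℝ → ℂ) =ᵐ[volume.restrict I] fun x => (φ x : ℂ)) :
    inner ℂ f y = ∫ x in I, φ x • y x := by
  rw [L2.inner_def]
  refine integral_congr_ae ?_
  filter_upwards [h] with x hx
  rw [hx, RCLike.inner_apply, Complex.conj_ofReal, Complex.real_smul, mul_comm]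

theorem maxOp_apply (c : AiryCoeffs E) (u : G.W3) (e : E) :
    G.maxOp c u e = (c.α e : ℂ) • G.D 3 u e + (c.β e : ℂ) • G.D 1 u e := rfl

/-- The adjoint of the minimal operator is contained in the negative of the maximal operator. -/
theorem exists_W3_of_forall_inner_maxOp (hlen : 0 < ⨅ e, (G.b e - G.a e)) (c : AiryCoeffs E)
    {y z : G.HΓ} (h : ∀ u : G.W3, IsTrl u 0 → IsTrr u 0 →
      inner ℂ (G.maxOp c u) y = -inner ℂ (u : G.HΓ) z) :
    ∃ v : G.W3, (v : G.HΓ) = y ∧ G.maxOp c v = z := by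
  obtain ⟨d, hd, hstep, -⟩ := G.exists_step hlen
  obtain ⟨m, B, hm, hB⟩ := c.exists_bounds
  obtain ⟨C, hC, hreg⟩ := exists_regularity_bound (B := B) hd hm
  -- Test functions living on one edge have zero traces, so the hypothesis becomes the weak equation
  -- `α y''' + β y' = z` on that edge, to which the regularity theorem applies.
  have key := fun e => hreg (G.edge e) (G.ordConnected_edge e) (G.isOpen_edge e) (hstep e)
    (c.α e) (c.β e) (hB e).1 (hB e).2.1 (hB e).2.2 (y e) (z e) (Lp.memLp _) (Lp.memLp _)
    fun φ hφ => by
      obtain ⟨u, hul, hur, hu0, hu⟩ := exists_W3_of_isTestOn hφ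
      have h1 := h u hul hur
      rw [inner_eq_inner_single (e₀ := e) fun e' he' => by
          rw [maxOp_apply, hu0 _ e' he', hu0 _ e' he', smul_zero, smul_zero, add_zero],
        ← D_zero, inner_eq_inner_single (e₀ := e) (hu0 0)] at h1
      have e0 : inner ℂ (G.D 0 u e) (z e) = ∫ x in G.edge e, φ x • z e x :=
        inner_eq_integral_smul ((hu 0).trans (ae_of_all _ fun x => by simp))
      have e3 : inner ℂ (G.maxOp c u e) (y e) =
          ∫ x in G.edge e, (c.α e * deriv (deriv (deriv φ)) x + c.β e * deriv φ x) • y e x := by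
        refine inner_eq_integral_smul ?_
        rw [maxOp_apply]
        filter_upwards [hu 1, hu 3, Lp.coeFn_add ((c.α e : ℂ) • G.D 3 u e)
          ((c.β e : ℂ) • G.D 1 u e), Lp.coeFn_smul (c.α e : ℂ) (G.D 3 u e),
          Lp.coeFn_smul (c.β e : ℂ) (G.D 1 u e)] with x a1 a3 b1 b2 b3
        rw [b1, Pi.add_apply, b2, b3, Pi.smul_apply, Pi.smul_apply, a1, a3]
        simp [iteratedDeriv_succ]
      rw [← e3, ← e0]
      exact h1
  choose U hjet hy heq hU using key
  -- The edgewise solutions belong to the Hilbert sum because `C` is the same for all edges.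
  obtain ⟨v, hv⟩ := exists_W3_of_isJetOn U hjet (fun e k => (hU e k).1)
    (((summable_norm_sq y).add (summable_norm_sq z)).mul_left C) fun e k => by
      refine (hU e k).2.trans (le_of_eq ?_)
      rw [ENNReal.ofReal_mul hC, ENNReal.ofReal_add (sq_nonneg _) (sq_nonneg _),
        ofReal_norm_sq_eq_lintegral, ofReal_norm_sq_eq_lintegral, lintegral_add_left'
          ((Lp.memLp (y e)).1.enorm.pow_const 2)]
  refine ⟨v, ?_, ?_⟩
  · ext1
    funext e
    rw [← D_zero]
    exact Lp.ext ((hv e 0).trans (hy e).symm)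
  · ext1
    funext e
    refine Lp.ext ?_
    rw [maxOp_apply]
    filter_upwards [hv e 1, hv e 3, Lp.coeFn_add ((c.α e : ℂ) • G.D 3 v e)
      ((c.β e : ℂ) • G.D 1 v e), Lp.coeFn_smul (c.α e : ℂ) (G.D 3 v e),
      Lp.coeFn_smul (c.β e : ℂ) (G.D 1 v e)] with x a1 a3 b1 b2 b3
    rw [b1, Pi.add_apply, b2, b3, Pi.smul_apply, Pi.smul_apply, a1, a3, ← heq e x]
    rfl

variable (c : AiryCoeffs E) (L : TraceSpace G.Er →ₗ.[ℂ] TraceSpace G.El)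

theorem mem_domAL_of_isTr_zero {u : G.W3} (hl : IsTrl u 0) (hr : IsTrr u 0) : u ∈ domAL L :=
  ⟨0, hr, by rw [LinearPMap.map_zero]; exact hl⟩

theorem mem_opAL_graph {p : G.HΓ × G.HΓ} : p ∈ (opAL c L).graph ↔
    ∃ u ∈ domAL L, ((u : G.W3) : G.HΓ) = p.1 ∧ G.maxOp c u = p.2 := by
  rw [LinearPMap.mem_graph_iff]
  constructor
  · rintro ⟨y, hy1, hy2⟩
    obtain ⟨⟨u, hu, huy⟩, -⟩ := y.2
    refine ⟨u, hu, ?_, ?_⟩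
    · rw [← hy1]
      exact huy
    · rw [← hy2]
      exact (LinearPMap.domRestrict_apply huy.symm).symm
  · rintro ⟨u, hu, hu1, hu2⟩
    refine ⟨⟨(u : G.HΓ), ⟨u, hu, rfl⟩, u.2⟩, hu1, ?_⟩
    rw [← hu2]
    exact LinearPMap.domRestrict_apply rfl

/-- For every `L`, the domain contains the test functions on single edges, whose traces are zero; a
vector orthogonal to all of them vanishes on each edge. -/
theorem dense_opAL_domain : Dense ((opAL c L).domain : Set G.HΓ) := by
  rw [Submodule.dense_iff_topologicalClosure_eq_top, Submodule.topologicalClosure_eq_top_iff,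
    Submodule.eq_bot_iff]
  intro w hw
  rw [Submodule.mem_orthogonal] at hw
  ext1
  funext e
  refine Lp.ext ?_
  have hloc : LocallyIntegrableOn (w e : ℝ → ℂ) (G.edge e) :=
    (Lp.memLp (w e)).locallyIntegrableOn_of_restrict
  refine (ae_eq_of_forall_integral_smul_eq (G.isOpen_edge e) hloc
    ((locallyIntegrable_const (0 : ℂ)).locallyIntegrableOn _) fun φ hφ => ?_).trans
      (Lp.coeFn_zero _ _ _).symm
  obtain ⟨u, hul, hur, hu0, hu⟩ := exists_W3_of_isTestOn hφ
  have h1 := hw u ⟨⟨u, mem_domAL_of_isTr_zero L hul hur, rfl⟩, u.2⟩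
  rw [← D_zero, inner_eq_inner_single (e₀ := e) (hu0 0),
    inner_eq_integral_smul (φ := φ) ((hu 0).trans (ae_of_all _ fun x => by simp))] at h1
  rw [h1]
  simp

/-- Testing with functions of zero trace shows that an element of the adjoint domain is some `v` in
`W₂³` on which the adjoint acts as `-Â`. Green's formula then reduces the adjoint relation to `⟨L x
| Tr_l v⟩ = ⟨x | Tr_r v⟩`, and by surjectivity of the traces every `x ∈ D(L)` is attained. -/
theorem mem_adjoint_opAL_graph (hlen : 0 < ⨅ e, (G.b e - G.a e)) {p : G.HΓ × G.HΓ} :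
    p ∈ (opAL c L).adjoint.graph ↔ ∃ v : G.W3, (v : G.HΓ) = p.1 ∧ G.maxOp c v = -p.2 ∧
      ∃ yl yr, IsTrl v yl ∧ IsTrr v yr ∧
        (yl, yr) ∈ kreinAdjointGraph (G.kreinR c) (G.kreinL c) L := by
  rw [LinearPMap.adjoint_graph_eq_graph_adjoint (dense_opAL_domain c L), Submodule.mem_adjoint_iff]
  have hgraph : (∀ a b, (a, b) ∈ (opAL c L).graph → inner ℂ b p.1 - inner ℂ a p.2 = 0) ↔
      ∀ u ∈ domAL L, inner ℂ (G.maxOp c u) p.1 = inner ℂ (u : G.HΓ) p.2 := by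
    constructor
    · intro h u hu
      exact sub_eq_zero.1 (h _ _ ((mem_opAL_graph c L).2 ⟨u, hu, rfl, rfl⟩))
    · intro h a b hab
      obtain ⟨u, hu, rfl, rfl⟩ := (mem_opAL_graph c L).1 hab
      exact sub_eq_zero.2 (h u hu)
  rw [hgraph]
  have hgreen : ∀ {v : G.W3} {yl yr}, IsTrl v yl → IsTrr v yr → (v : G.HΓ) = p.1 →
      G.maxOp c v = -p.2 → ∀ {u : G.W3} {xl xr}, IsTrl u xl → IsTrr u xr →
      (inner ℂ (G.maxOp c u) p.1 = inner ℂ (u : G.HΓ) p.2 ↔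
        (G.kreinL c).form xl yl = (G.kreinR c).form xr yr) := by
    intro v yl yr hvl hvr hv1 hv2 u xl xr hul hur
    have h1 := inner_maxOp_add c hul hvl hur hvr
    rw [hv1, hv2, inner_neg_right, ← sub_eq_add_neg] at h1
    rw [← sub_eq_zero, h1, sub_eq_zero]
  constructor
  · intro h
    obtain ⟨v, hv1, hv2⟩ := exists_W3_of_forall_inner_maxOp hlen c (y := p.1) (z := -p.2)
      fun u hul hur => by
        rw [inner_neg_right, neg_neg]
        exact h u (mem_domAL_of_isTr_zero L hul hur)
    obtain ⟨yl, hvl⟩ := exists_isTrl hlen v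
    obtain ⟨yr, hvr⟩ := exists_isTrr hlen v
    refine ⟨v, hv1, hv2, yl, yr, hvl, hvr, fun x => ?_⟩
    obtain ⟨u, hul, hur⟩ := exists_W3_of_traces hlen (L x) (x : TraceSpace G.Er)
    exact (hgreen hvl hvr hv1 hv2 hul hur).1 (h u ⟨x, hur, hul⟩)
  · rintro ⟨v, hv1, hv2, yl, yr, hvl, hvr, hK⟩ u ⟨x, hur, hul⟩
    exact (hgreen hvl hvr hv1 hv2 hul hur).2 (hK x)

/-- Both operators are restrictions of `-Â`, so only their trace conditions have to be compared;
surjectivity and uniqueness of traces turn this into a comparison of two relations between the trace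
spaces. -/
theorem adjoint_opAL_eq_neg_iff (hlen : 0 < ⨅ e, (G.b e - G.a e)) :
    (opAL c L).adjoint = -opAL c L ↔ ∀ yl yr,
      (yl, yr) ∈ kreinAdjointGraph (G.kreinR c) (G.kreinL c) L ↔ (yr, yl) ∈ L.graph := by
  have hneg : ∀ p : G.HΓ × G.HΓ, p ∈ (-opAL c L).graph ↔
      ∃ u ∈ domAL L, ((u : G.W3) : G.HΓ) = p.1 ∧ G.maxOp c u = -p.2 := by
    intro p
    rw [LinearPMap.neg_graph, Submodule.mem_map]
    constructor
    · rintro ⟨q, hq, rfl⟩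
      obtain ⟨u, hu, hu1, hu2⟩ := (mem_opAL_graph c L).1 hq
      exact ⟨u, hu, hu1, by simpa using hu2⟩
    · rintro ⟨u, hu, hu1, hu2⟩
      refine ⟨(p.1, -p.2), (mem_opAL_graph c L).2 ⟨u, hu, hu1, hu2⟩, ?_⟩
      ext1 <;> simp
  constructor
  · intro h yl yr
    obtain ⟨v, hvl, hvr⟩ := exists_W3_of_traces hlen yl yr
    have h1 : ((v : G.HΓ), -G.maxOp c v) ∈ (opAL c L).adjoint.graph ↔
        ((v : G.HΓ), -G.maxOp c v) ∈ (-opAL c L).graph := by rw [h]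
    rw [mem_adjoint_opAL_graph c L hlen, hneg] at h1
    constructor
    · intro hK
      obtain ⟨u, ⟨x, hxr, hxl⟩, hu1, -⟩ := h1.1 ⟨v, rfl, by simp, yl, yr, hvl, hvr, hK⟩
      obtain rfl : u = v := Subtype.ext hu1
      rw [hvr.unique hxr, hvl.unique hxl]
      exact L.mem_graph x
    · intro hK
      obtain ⟨x, hx1, hx2⟩ := (LinearPMap.mem_graph_iff _).1 hK
      obtain ⟨u, hu1, -, zl, zr, hzl, hzr, hz⟩ := h1.2 ⟨v, ⟨x, by rw [hx1]; exact hvr,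
        by rw [hx2]; exact hvl⟩, rfl, by simp⟩
      obtain rfl : u = v := Subtype.ext hu1
      rw [hvl.unique hzl, hvr.unique hzr]
      exact hz
  · intro h
    refine LinearPMap.eq_of_eq_graph (Submodule.ext fun p => ?_)
    rw [mem_adjoint_opAL_graph c L hlen, hneg]
    constructor
    · rintro ⟨v, hv1, hv2, yl, yr, hvl, hvr, hK⟩
      obtain ⟨x, hx1, hx2⟩ := (LinearPMap.mem_graph_iff _).1 ((h yl yr).1 hK)
      exact ⟨v, ⟨x, by rw [hx1]; exact hvr, by rw [hx2]; exact hvl⟩, hv1, hv2⟩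
    · rintro ⟨u, ⟨x, hxr, hxl⟩, hu1, hu2⟩
      exact ⟨u, hu1, hu2, L x, x, hxl, hxr, (h _ _).2 (L.mem_graph x)⟩

end MetricGraph

/-! ### Krein unitarity as an identity of graphs -/

/-- The graph identity already implies injectivity: if `L x = L x'`, then `(0, x - x')` lies in the
graph of `L♯`, which is single-valued because `D(L)` is dense. The graph of `L.inverse` is the
flipped graph of `L` only once injectivity is known. -/
theorem isKreinUnitary_iff {K₁ K₂ : Type*} [NormedAddCommGroup K₁] [InnerProductSpace ℂ K₁]
    [CompleteSpace K₁] [NormedAddCommGroup K₂] [InnerProductSpace ℂ K₂] [CompleteSpace K₂]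
    (𝒦₁ : KreinSpace K₁) (𝒦₂ : KreinSpace K₂) (L : K₁ →ₗ.[ℂ] K₂)
    (hdom : Dense (L.domain : Set K₁)) (hran : Dense (Set.range L)) :
    IsKreinUnitary 𝒦₁ 𝒦₂ L ↔ ∀ y z, (y, z) ∈ kreinAdjointGraph 𝒦₁ 𝒦₂ L ↔ (z, y) ∈ L.graph := by
  have hmap : ∀ y z, (y, z) ∈ L.graph.map
      (LinearEquiv.prodComm ℂ K₁ K₂ : (K₁ × K₂) →ₗ[ℂ] (K₂ × K₁)) ↔
      (z, y) ∈ L.graph := fun y z => by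
    rw [Submodule.mem_map]
    constructor
    · rintro ⟨q, hq, hqe⟩
      obtain ⟨rfl, rfl⟩ := Prod.mk.inj hqe
      exact hq
    · exact fun h => ⟨(z, y), h, rfl⟩
  constructor
  · rintro ⟨-, -, hinj, heq⟩ y z
    have hker : LinearMap.ker L.toFun = ⊥ := LinearMap.ker_eq_bot.2 hinj
    rw [← kreinAdjoint_graph 𝒦₁ 𝒦₂ L hdom, heq, LinearPMap.inverse_graph hker, hmap]
  · intro h
    have hinj : Function.Injective L := fun x x' hxx => by
      have h1 : ((0 : K₂), (x : K₁) - x') ∈ L.graph.map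
          (LinearEquiv.prodComm ℂ K₁ K₂ : (K₁ × K₂) →ₗ[ℂ] (K₂ × K₁)) := by
        rw [hmap]
        have := L.graph.sub_mem (L.mem_graph x) (L.mem_graph x')
        simpa [hxx] using this
      have h2 := kreinAdjointGraph_snd_eq_zero 𝒦₁ 𝒦₂ L hdom _ ((h _ _).2 ((hmap _ _).1 h1)) rfl
      exact Subtype.ext (sub_eq_zero.1 h2)
    have hker : LinearMap.ker L.toFun = ⊥ := LinearMap.ker_eq_bot.2 hinj
    refine ⟨hdom, hran, hinj, LinearPMap.eq_of_eq_graph (Submodule.ext fun p => ?_)⟩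
    rw [kreinAdjoint_graph 𝒦₁ 𝒦₂ L hdom, LinearPMap.inverse_graph hker]
    exact (h p.1 p.2).trans (hmap p.1 p.2).symm

theorem mainTheorem1 {V E : Type*} (G : MetricGraph V E)
    (hlen : 0 < ⨅ e, (G.b e - G.a e)) (c : AiryCoeffs E)
    (L : TraceSpace G.Er →ₗ.[ℂ] TraceSpace G.El)
    (hdom : Dense (L.domain : Set (TraceSpace G.Er)))
    (hran : Dense (Set.range L)) :
    IsSkewSelfAdjointOp (MetricGraph.opAL c L) ↔
      IsKreinUnitary (G.kreinR c) (G.kreinL c) L := by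
  rw [isKreinUnitary_iff _ _ L hdom hran, ← MetricGraph.adjoint_opAL_eq_neg_iff c L hlen]
  exact ⟨fun h => h.2, fun h => ⟨MetricGraph.dense_opAL_domain c L, h⟩⟩
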